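/- Notation. Let $2\le k\le n$, let $\sigma_j(\lambda)=\sum_{i_1<\dots<i_j}\lambda_{i_1}\cdots\lambda_{i_j}$ and $\Gamma_k=\{\lambda\in\mathbb R^n:\sigma_j(\lambda)>0,\ j=1,\dots,k\}$. For a symmetric matrix $A$ with eigenvalues $\lambda(A)$ put $F(A)=\sigma_k(\lambda(A))^{1/k}$, and let $\mathcal M_k$ be the set of positive definite symmetric matrices $M$ of the form $M^{ij}=\frac{\partial F}{\partial A_{ij}}(T)$ for some symmetric $T$ with $\lambda(T)\in\Gamma_k$. With $\delta(u,x,y)=u(x+y)+u(x-y)-2u(x)$ and $\theta>0$ put $$F_s[u](x)=\inf_{M\in\mathcal M_k}\ \frac12\int_{\mathbb R^n}\frac{\delta(u,x,y)}{|\sqrt M^{-1}y|^{n+2s}}\det\sqrt M^{-1}\,dy,$$ and let $F_s^\theta[u](x)$ be the infimum of the same integrals over those $M\in\mathcal M_k$ whose smallest eigenvalue satisfies $\lambda_{\min}(M)\ge\theta$. The integrals are taken with values in $[-\infty,+\infty]$, and the infimum over the empty set is $+\infty$. For an open set $\Omega\subset\mathbb R^n$, the inequality $(1-s)F_s[u]\ge\eta_0$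 holds on $\Omega$ in the viscosity sense if $u$ is upper semicontinuous on $\overline\Omega$ and the following holds: whenever $x\in\Omega$, $N\subset\Omega$ is an open neighborhood of $x$, $\psi$ is a $C^2$ function on $\overline N$ with $\psi(x)=u(x)$ and $\psi(y)>u(y)$ for all $y\in N\setminus\{x\}$, and $v=\psi$ in $N$, $v=u$ in $\mathbb R^n\setminus N$, then $(1-s)F_s[v](x)\ge\eta_0$. Theorem. Let $2\le k\le n$, $\eta_0>0$, $L\ge0$ and $SC\ge0$. For every $s\in(\tfrac12,1)$ there is a constant $\theta=\theta(s)>0$, depending only on $n,k,\eta_0,s,L,SC$, such that the following holds. Let $\Omega\subset\mathbb R^n$ be open and let $u:\mathbb R^n\to\mathbb R$ be convex, Lipschitz continuous with constant $L$, and semi-concave with constant $SC$, that is, $\delta(u,x,y)\le SC\,|y|^2$ for all $x,y\in\mathbb R^n$. If $(1-s)F_s[u]\ge\eta_0$ on $\Omega$ in the viscosity sense, then $$F_s[u](x)=F_s^{\theta}[u](x)\qquad\text{for all }x\in\Omega .$$ Furthermore, the constants $\theta(s)$ can be chosen so that they stay away from $0$ as $s\to1$: there is $\theta_0>0$ with $\theta(s)\ge\theta_0$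 for all $s<1$ sufficiently close to $1$. -/

import Mathlib

open scoped NNReal Topology

noncomputable section

namespace FracHessian

/-- Euclidean space `ℝⁿ`. -/
abbrev E (n : ℕ) := EuclideanSpace ℝ (Fin n)

/-- The elementary symmetric function `σ_k(λ) = ∑_{i₁ < ⋯ < i_k} λ_{i₁} ⋯ λ_{i_k}`. -/
def sigma {n : ℕ} (k : ℕ) (lam : Fin n → ℝ) : ℝ :=
  ∑ S ∈ Finset.powersetCard k (Finset.univ : Finset (Fin n)), ∏ i ∈ S, lam i

/-- The Gårding cone `Γ_k = {λ ∈ ℝⁿ : σ_j(λ) > 0, j = 1, …, k}`. -/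
def gardingCone (n k : ℕ) : Set (Fin n → ℝ) :=
  {lam | ∀ j, 1 ≤ j → j ≤ k → 0 < sigma j lam}

/-- The function `f = σ_k^{1/k}` of the eigenvalues. -/
def sigmaRoot {n : ℕ} (k : ℕ) (lam : Fin n → ℝ) : ℝ :=
  sigma k lam ^ (1 / (k : ℝ))

/-- The eigenvalues `λ(A)` (with multiplicity) of a real symmetric matrix `A`;
the value `0` for a matrix that is not symmetric is never used. -/
def eigs {n : ℕ} (A : Matrix (Fin n) (Fin n) ℝ) : Fin n → ℝ :=
  open scoped Classical in if h : A.IsHermitian then h.eigenvalues else 0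

/-- The smallest eigenvalue `λ_min(M)` of a symmetric matrix. -/
def lambdaMin {n : ℕ} (M : Matrix (Fin n) (Fin n) ℝ) : ℝ := ⨅ i, eigs M i

/-- `M` is the matrix `(F^{ij}(T)) = (∂F/∂A_{ij}(T))` for the function `F(A) = f(λ(A))` of
symmetric matrices: for each symmetric direction `B`, the derivative of `F` at `T` in the
direction `B` is `∑ M^{ij} B_{ij} = trace (M B)`. -/
def IsMatrixGradient {n : ℕ} (f : (Fin n → ℝ) → ℝ) (T M : Matrix (Fin n) (Fin n) ℝ) : Prop :=
  ∀ B : Matrix (Fin n) (Fin n) ℝ, B.IsSymm →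
    HasDerivAt (fun t : ℝ => f (eigs (T + t • B))) (M * B).trace 0

/-- The set `𝓜` of the positive definite symmetric matrices `M` for which there is a symmetric `T`
with `λ(T) ∈ Γ` and `M^{ij} = F^{ij}(T)`, where `F(A) = f(λ(A))`. -/
def coeffs {n : ℕ} (f : (Fin n → ℝ) → ℝ) (Γ : Set (Fin n → ℝ)) :
    Set (Matrix (Fin n) (Fin n) ℝ) :=
  {M | M.PosDef ∧ ∃ T : Matrix (Fin n) (Fin n) ℝ, T.IsSymm ∧ eigs T ∈ Γ ∧ IsMatrixGradient f T M}

/-- The second difference `δ(u,x,y) = u(x+y) + u(x-y) - 2u(x)`. -/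
def delta {n : ℕ} (u : E n → ℝ) (x y : E n) : ℝ := u (x + y) + u (x - y) - 2 * u x

/-- The Lebesgue integral of a real function with values in `[-∞, ∞]`: the integral of the
positive part minus that of the negative part (and `⊤ - ⊤ = ⊥`). -/
def extIntegral {n : ℕ} (g : E n → ℝ) : EReal :=
  ((∫⁻ y, ENNReal.ofReal (g y) : ENNReal) : EReal) -
    ((∫⁻ y, ENNReal.ofReal (-g y) : ENNReal) : EReal)

open scoped MatrixOrder in
/-- The linear operator `½ ∫ δ(u,x,y) |√M⁻¹ y|^{-(n+2s)} det √M⁻¹ dy`. -/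
def linOp {n : ℕ} (s : ℝ) (M : Matrix (Fin n) (Fin n) ℝ) (u : E n → ℝ) (x : E n) : EReal :=
  extIntegral fun y => 1 / 2 *
    (delta u x y / ‖Matrix.toLpLin 2 2 (CFC.sqrt M)⁻¹ y‖ ^ ((n : ℝ) + 2 * s) *
      ((CFC.sqrt M)⁻¹).det)

/-- The infimum of the linear operators above over a set of matrices
(`⊤` if the set is empty). -/
def infOp {n : ℕ} (𝓜 : Set (Matrix (Fin n) (Fin n) ℝ)) (s : ℝ) (u : E n → ℝ) (x : E n) : EReal :=
  ⨅ M ∈ 𝓜, linOp s M u x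

/-- The set `𝓜_k`, i.e. `𝓜` for `f = σ_k^{1/k}` on `Γ_k`. -/
def coeffsK (n k : ℕ) : Set (Matrix (Fin n) (Fin n) ℝ) :=
  coeffs (sigmaRoot k) (gardingCone n k)

/-- The fractional `k`-Hessian operator `F_s[u](x)`. -/
def fracHess {n : ℕ} (k : ℕ) (s : ℝ) (u : E n → ℝ) (x : E n) : EReal :=
  infOp (coeffsK n k) s u x

/-- The strictly elliptic operator `F_s^θ[u](x)`: the infimum is restricted to `λ_min(M) ≥ θ`. -/
def fracHessTheta {n : ℕ} (k : ℕ) (s θ : ℝ) (u : E n → ℝ) (x : E n) : EReal :=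
  infOp {M ∈ coeffsK n k | θ ≤ lambdaMin M} s u x

/-- `u` is semiconcave in `A` with semiconcavity constant `SC`. -/
def IsSemiconcaveOn {n : ℕ} (A : Set (E n)) (u : E n → ℝ) (SC : ℝ) : Prop :=
  ContinuousOn u A ∧ 0 ≤ SC ∧
    ∀ x y : E n, segment ℝ (x - y) (x + y) ⊆ A → delta u x y ≤ SC * ‖y‖ ^ 2

/-- `𝓕 u ≥ g` in `Ω` in the viscosity sense, for an operator `𝓕` acting on functions on `ℝⁿ`:
`u` is upper semicontinuous in the closure of `Ω`, and whenever a `C²` function `ψ` touches `u`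
strictly from above at `x` in an open neighborhood `N ⊆ Ω` of `x`, the function
`v = ψ` in `N`, `v = u` outside `N`, satisfies `𝓕[v](x) ≥ g(x)`. -/
def IsViscositySubsolution {n : ℕ} (𝓕 : (E n → ℝ) → E n → EReal) (g : E n → ℝ)
    (Ω : Set (E n)) (u : E n → ℝ) : Prop :=
  UpperSemicontinuousOn u (closure Ω) ∧
    ∀ x ∈ Ω, ∀ N : Set (E n), IsOpen N → x ∈ N → N ⊆ Ω →
      ∀ ψ : E n → ℝ, ContDiffOn ℝ 2 ψ (closure N) → ψ x = u x →
        (∀ y ∈ N \ {x}, u y < ψ y) →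
          (g x : EReal) ≤ 𝓕 (open scoped Classical in N.piecewise ψ u) x

end FracHessian

end

/-!
Fix `x ∈ Ω` and put `w(y) = δ(u,x,y)`. Convexity, semiconcavity and the Lipschitz bound make `w` an
even convex function with `0 ≤ w(y) ≤ min(SC |y|², 2 L |y|)`. If `M = U diag(m) Uᵀ`, then the linear
operator with the matrix `M` is half the integral `∫ w(U diag(√m) z) |z|^{-(n+2s)} dz`
(`lintegral_kernel_eq`). This integral is monotone in the factors `√m_i`
(`scaledIntegral_mono`), because `w` is convex and the measure is invariant under sign changes of
the coordinates; times `1 - s` it is bounded by a constant that is uniform as `s → 1`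
(`mul_scaledIntegral_le`).

*Nearly degenerate matrices are large in most directions.* The function `σ_k^{1/k}` is concave on
`Γ_k` (`sigmaRoot_superadditive`), so the eigenvalues `m` of `M ∈ 𝓜_k` satisfy
`σ_k(β)^{1/k} ≤ ∑ m_i β_i` for all `β ∈ Γ_k` (`exists_eigenvalues_of_mem_coeffsK`). Testing this
with suitable `β` shows that if one `m_i` is very small, then the largest one is very large, and all
but at most `k - 1` eigenvalues are comparable to the largest (`exists_forall_card_lt`).

*`u` is nondegenerate in these directions.* A paraboloid touches `u` from above at `x`, so the
viscosity inequality gives `(1 - s) L_M u(x) ≥ η₀` for every `M ∈ 𝓜_k`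
(`le_scaledIntegral_of_viscosity`). Given a set `S` of at most `k - 1` eigendirections, `𝓜_k`
contains a matrix with the same eigenvectors that is small on `S` and bounded off `S`, namely the
gradient of `σ_k^{1/k}` at a matrix that is large on `S` and small off `S`. By convexity of `w` the
directions in `S` can be split off, and their contribution is absorbed. Hence the integral over the
other directions alone, with a fixed scaling factor, is at least a multiple of `η₀ / (1 - s)`
(`le_scaledIntegral_off`).

Combining the two, `(1 - s) L_M u(x)` is as large as desired if `λ_min(M)` is small, hence larger
than the value at one fixed matrix of `𝓜_k`, and such `M` do not affect the infimum
(`exists_theta`). All constants depend on `s` only through a lower bound `s₀ > 1/2`.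
-/

namespace FracHessian

/-! ### Elementary symmetric functions and Newton's inequality -/

section Esym

set_option linter.unusedSectionVars false

variable {ι : Type*} [DecidableEq ι]

/-- The elementary symmetric function of degree `k` in the variables `x i`, `i ∈ S`. Working with
finsets makes the deletion of a variable an `erase`. -/
def esym (S : Finset ι) (k : ℕ) (x : ι → ℝ) : ℝ :=
  ∑ T ∈ Finset.powersetCard k S, ∏ i ∈ T, x i

lemma esym_zero (S : Finset ι) (x : ι → ℝ) : esym S 0 x = 1 := by
  simp [esym]

lemma esym_eq_zero_of_card_lt {S : Finset ι} {k : ℕ} (h : S.card < k) (x : ι → ℝ) :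
    esym S k x = 0 := by
  simp [esym, Finset.powersetCard_eq_empty.2 h]

lemma esym_insert {S : Finset ι} {a : ι} (ha : a ∉ S) (k : ℕ) (x : ι → ℝ) :
    esym (insert a S) (k + 1) x = esym S (k + 1) x + x a * esym S k x := by
  unfold esym
  rw [Finset.powersetCard_succ_insert ha, Finset.sum_union, Finset.sum_image, Finset.mul_sum]
  · congr 1
    refine Finset.sum_congr rfl fun T hT => ?_
    rw [Finset.prod_insert fun h => ha ((Finset.mem_powersetCard.1 hT).1 h)]
  · intro T hT U hU h
    have hT' : a ∉ T := fun h => ha ((Finset.mem_powersetCard.1 hT).1 h)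
    have hU' : a ∉ U := fun h => ha ((Finset.mem_powersetCard.1 hU).1 h)
    rw [← Finset.erase_insert hT', h, Finset.erase_insert hU']
  · rw [Finset.disjoint_left]
    intro T hT hT'
    obtain ⟨U, -, rfl⟩ := Finset.mem_image.1 hT'
    exact ha ((Finset.mem_powersetCard.1 hT).1 (Finset.mem_insert_self a U))

lemma esym_succ_eq_erase {S : Finset ι} {a : ι} (ha : a ∈ S) (k : ℕ) (x : ι → ℝ) :
    esym S (k + 1) x = esym (S.erase a) (k + 1) x + x a * esym (S.erase a) k x := by
  conv_lhs => rw [← Finset.insert_erase ha]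
  exact esym_insert (Finset.notMem_erase a S) k x

/-- Euler's identity for the homogeneous polynomial `e_{k+1}`. -/
lemma sum_mul_esym_erase (S : Finset ι) (k : ℕ) (x : ι → ℝ) :
    ∑ i ∈ S, x i * esym (S.erase i) k x = (k + 1) * esym S (k + 1) x := by
  induction S using Finset.induction_on generalizing k with
  | empty => simp [esym_eq_zero_of_card_lt (S := (∅ : Finset ι)) (k := k + 1) (by simp)]
  | insert a S ha ih =>
    rw [Finset.sum_insert ha, Finset.erase_insert ha, esym_insert ha]
    have h : ∀ i ∈ S, (insert a S).erase i = insert a (S.erase i) := fun i hi =>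
      Finset.erase_insert_of_ne (by rintro rfl; exact ha hi)
    have ha' : ∀ i, a ∉ S.erase i := fun i hi => ha (Finset.mem_of_mem_erase hi)
    cases k with
    | zero =>
      have := ih 0
      simp only [esym_zero, mul_one, Nat.cast_zero, zero_add, one_mul] at this ⊢
      rw [this]; ring
    | succ k =>
      have h2 : ∑ i ∈ S, x i * esym ((insert a S).erase i) (k + 1) x =
          ∑ i ∈ S, (x i * esym (S.erase i) (k + 1) x +
            x a * (x i * esym (S.erase i) k x)) := by
        refine Finset.sum_congr rfl fun i hi => ?_
        rw [h i hi, esym_insert (ha' i)]; ring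
      rw [h2, Finset.sum_add_distrib, ← Finset.mul_sum, ih, ih]
      push_cast; ring

open Polynomial in
lemma splits_derivative {p : ℝ[X]} (hp : p.Splits) : (derivative p).Splits := by
  rw [splits_iff_card_roots] at hp ⊢
  have h1 := card_roots_le_derivative p
  have h2 := natDegree_derivative_le p
  have h3 := card_roots' (derivative p)
  by_cases h : p.natDegree = 0
  · rw [derivative_of_natDegree_zero h]; simp
  · omega

open Polynomial in
/-- The Laguerre inequality for real-rooted polynomials. -/
lemma eval_mul_eval_derivative_le {p : ℝ[X]} (hp : p.Splits) (x : ℝ) :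
    p.eval x * (derivative (derivative p)).eval x ≤ (derivative p).eval x ^ 2 := by
  rw [hp.eq_prod_roots]
  generalize p.leadingCoeff = c
  generalize p.roots = s
  have key : ∀ s : Multiset ℝ, 0 ≤ (derivative (s.map fun r => X - C r).prod).eval x ^ 2 -
      (s.map fun r => X - C r).prod.eval x *
        (derivative (derivative (s.map fun r => X - C r).prod)).eval x := by
    intro s
    induction s using Multiset.induction_on with
    | empty => simp
    | cons a s ih =>
      simp only [Multiset.map_cons, Multiset.prod_cons, derivative_mul, derivative_sub,
        derivative_X, derivative_C, sub_zero, one_mul, derivative_add, eval_add, eval_mul,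
        eval_sub, eval_X, eval_C]
      set q := (s.map fun r => X - C r).prod
      nlinarith [mul_nonneg (sq_nonneg (x - a)) ih, sq_nonneg (q.eval x)]
  have := mul_nonneg (sq_nonneg c) (key s)
  simp only [derivative_C_mul, eval_mul, eval_C]
  nlinarith

open Polynomial in
/-- Newton's inequality, in the weak form `e_k e_{k+2} ≤ e_{k+1}²`, for arbitrary real variables:
a derivative of `∏ (X + x i)` is real-rooted, and its lowest coefficients are multiples of
`e_{k+2}, e_{k+1}, e_k`. -/
lemma esym_mul_esym_le (S : Finset ι) (k : ℕ) (x : ι → ℝ) :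
    esym S k x * esym S (k + 2) x ≤ esym S (k + 1) x ^ 2 := by
  by_cases hk : k + 2 ≤ S.card
  swap
  · rw [esym_eq_zero_of_card_lt (not_le.1 hk), mul_zero]; positivity
  obtain ⟨m, hm⟩ := Nat.exists_eq_add_of_le' hk
  set P : ℝ[X] := ∏ i ∈ S, (X + C (x i))
  have hP : P.Splits := Splits.prod fun i _ => Splits.X_add_C _
  have hQ : ∀ j, (derivative^[j] P).Splits := by
    intro j
    induction j with
    | zero => exact hP
    | succ j ih => rw [Function.iterate_succ_apply']; exact splits_derivative ih
  have hc : ∀ j ≤ S.card, P.coeff j = esym S (S.card - j) x := fun j hj =>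
    Finset.prod_X_add_C_coeff S x hj
  have hev : ∀ j ≤ S.card, (derivative^[j] P).eval 0 = j.factorial * esym S (S.card - j) x := by
    intro j hj
    rw [← coeff_zero_eq_eval_zero, coeff_iterate_derivative, zero_add, Nat.descFactorial_self,
      hc j hj, nsmul_eq_mul]
  have h := eval_mul_eval_derivative_le (hQ m) 0
  rw [← Function.iterate_succ_apply' (f := derivative), ← Function.iterate_succ_apply'
    (f := derivative), hev m (by omega), hev (m + 1) (by omega), hev (m + 1 + 1) (by omega),
    show S.card - m = k + 2 by omega, show S.card - (m + 1) = k + 1 by omega,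
    show S.card - (m + 1 + 1) = k by omega, Nat.factorial_succ (m + 1), Nat.factorial_succ m] at h
  by_cases h0 : esym S k x * esym S (k + 2) x ≤ 0
  · exact h0.trans (sq_nonneg _)
  push Not at h0
  have hf : (0 : ℝ) < (m.factorial : ℝ) ^ 2 := by positivity
  push_cast at h
  have h1 : ((m : ℝ) + 1) * (m + 2) * (esym S k x * esym S (k + 2) x) ≤
      ((m : ℝ) + 1) ^ 2 * esym S (k + 1) x ^ 2 := by
    refine le_of_mul_le_mul_left ?_ hf
    nlinarith
  have h2 : ((m : ℝ) + 1) ^ 2 * (esym S k x * esym S (k + 2) x) ≤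
      ((m : ℝ) + 1) * (m + 2) * (esym S k x * esym S (k + 2) x) :=
    mul_le_mul_of_nonneg_right (by nlinarith) h0.le
  exact le_of_mul_le_mul_left (h2.trans h1) (by positivity)

/-! ### The Gårding cone and the concavity of `σ_k^{1/k}` -/

/-- The Gårding cone in the variables `x i`, `i ∈ S`. -/
def Gamma (S : Finset ι) (k : ℕ) : Set (ι → ℝ) := {x | ∀ j, j ≤ k → 0 < esym S j x}

lemma Gamma_mono {S : Finset ι} {k l : ℕ} (h : k ≤ l) : Gamma S l ⊆ Gamma S k :=
  fun _ hx j hj => hx j (hj.trans h)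

/-- Deleting a variable maps `Γ_{k+1}` to `Γ_k`. If `e_{j+1}` without the variable were not
positive, then the recursion for `e_{j+1}`, `e_{j+2}` would contradict Newton's inequality. -/
lemma Gamma_erase {S : Finset ι} {a : ι} (ha : a ∈ S) {k : ℕ} {x : ι → ℝ}
    (hx : x ∈ Gamma S (k + 1)) : x ∈ Gamma (S.erase a) k := by
  intro j hj
  induction j with
  | zero => simp [esym_zero]
  | succ j ih =>
    have ih := ih (by omega)
    by_contra! hneg
    have h1 := hx (j + 1) (by omega)
    have h2 := hx (j + 2) (by omega)
    rw [esym_succ_eq_erase ha] at h1 h2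
    have hN := esym_mul_esym_le (S.erase a) j x
    nlinarith

/-- The quotient `e_{k+1}/e_k`. -/
noncomputable def esymQuot (S : Finset ι) (k : ℕ) (x : ι → ℝ) : ℝ := esym S (k + 1) x / esym S k x

/-- `(x, q) ↦ x q / (x + q)` is superadditive where `x + q > 0`. -/
lemma div_add_div_le_harmonic {x y p q : ℝ} (h1 : 0 < x + p) (h2 : 0 < y + q) :
    x * p / (x + p) + y * q / (y + q) ≤ (x + y) * (p + q) / ((x + y) + (p + q)) := by
  have h3 : 0 < (x + y) + (p + q) := by linarith
  rw [div_add_div _ _ h1.ne' h2.ne', div_le_div_iff₀ (mul_pos h1 h2) h3]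
  nlinarith [sq_nonneg (x * q - y * p)]

/-- `q ↦ x q / (x + q)` is monotone where `x + q > 0`. -/
lemma harmonic_mono {x p q : ℝ} (h1 : 0 < x + p) (h : p ≤ q) :
    x * p / (x + p) ≤ x * q / (x + q) := by
  rw [div_le_div_iff₀ h1 (by linarith)]
  nlinarith [mul_nonneg (sq_nonneg x) (sub_nonneg.2 h)]

lemma add_esymQuot_erase {S : Finset ι} {a : ι} (ha : a ∈ S) {k : ℕ} {x : ι → ℝ}
    (hx : x ∈ Gamma S (k + 1)) :
    x a + esymQuot (S.erase a) k x = esym S (k + 1) x / esym (S.erase a) k x := by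
  have h := (Gamma_erase ha hx k le_rfl).ne'
  rw [esym_succ_eq_erase ha, esymQuot]
  field_simp
  ring

/-- The recursion expressing `e_{k+2}/e_{k+1}` through harmonic sums of `x i` and the quotient
`e_{k+1}/e_k` without the variable `x i`. -/
lemma succ_mul_esymQuot {S : Finset ι} {k : ℕ} {x : ι → ℝ} (hx : x ∈ Gamma S (k + 1)) :
    ((k : ℝ) + 2) * esymQuot S (k + 1) x =
      ∑ i ∈ S, x i * esymQuot (S.erase i) k x / (x i + esymQuot (S.erase i) k x) := by
  have hS := (hx (k + 1) le_rfl).ne'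
  have h1 : ((k : ℝ) + 2) * esymQuot S (k + 1) x =
      (∑ i ∈ S, x i * esym (S.erase i) (k + 1) x) / esym S (k + 1) x := by
    rw [sum_mul_esym_erase, esymQuot]; push_cast; ring
  rw [h1, Finset.sum_div]
  refine Finset.sum_congr rfl fun i hi => ?_
  have h := (Gamma_erase hi hx k le_rfl).ne'
  rw [add_esymQuot_erase hi hx, esymQuot]
  field_simp

/-- `Γ_{k+1}` is closed under addition and `e_{k+1}/e_k` is superadditive there. -/
lemma Gamma_add_and_esymQuot_superadditive (k : ℕ) : ∀ (S : Finset ι) (x y : ι → ℝ),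
    x ∈ Gamma S (k + 1) → y ∈ Gamma S (k + 1) →
      x + y ∈ Gamma S (k + 1) ∧ esymQuot S k x + esymQuot S k y ≤ esymQuot S k (x + y) := by
  induction k with
  | zero =>
    intro S x y hx hy
    have h1 : ∀ z : ι → ℝ, esym S 1 z = ∑ i ∈ S, z i := fun z => by
      simpa [esym_zero] using (sum_mul_esym_erase S 0 z).symm
    have h2 : esym S 1 (x + y) = esym S 1 x + esym S 1 y := by
      simp [h1, Finset.sum_add_distrib]
    constructor
    · intro j hj
      interval_cases j
      · simp [esym_zero]
      · have := hx 1 le_rfl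
        have := hy 1 le_rfl
        rw [h2]; positivity
    · simp [esymQuot, esym_zero, h2]
  | succ k ih =>
    intro S x y hx hy
    have hx' := Gamma_mono (Nat.le_succ _) hx
    have hy' := Gamma_mono (Nat.le_succ _) hy
    have hxy := (ih S x y hx' hy').1
    have hpos : ∀ {z : ι → ℝ}, z ∈ Gamma S (k + 1) → ∀ i ∈ S,
        0 < z i + esymQuot (S.erase i) k z := by
      intro z hz i hi
      rw [add_esymQuot_erase hi hz]
      exact div_pos (hz _ le_rfl) (Gamma_erase hi hz k le_rfl)
    have hq : esymQuot S (k + 1) x + esymQuot S (k + 1) y ≤ esymQuot S (k + 1) (x + y) := by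
      have hk : (0 : ℝ) < (k : ℝ) + 2 := by positivity
      refine le_of_mul_le_mul_left ?_ hk
      rw [mul_add, succ_mul_esymQuot hx', succ_mul_esymQuot hy', succ_mul_esymQuot hxy,
        ← Finset.sum_add_distrib]
      refine Finset.sum_le_sum fun i hi => ?_
      have hi' := (ih (S.erase i) x y (Gamma_erase hi hx) (Gamma_erase hi hy)).2
      have h1 := hpos hx' i hi
      have h2 := hpos hy' i hi
      refine (div_add_div_le_harmonic h1 h2).trans (harmonic_mono ?_ hi')
      linarith
    refine ⟨?_, hq⟩
    intro j hj
    rcases Nat.lt_or_ge j (k + 2) with h | h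
    · exact hxy j (by omega)
    obtain rfl : j = k + 1 + 1 := by omega
    have h1 : 0 < esymQuot S (k + 1) (x + y) :=
      (add_pos (div_pos (hx _ le_rfl) (hx' _ le_rfl))
        (div_pos (hy _ le_rfl) (hy' _ le_rfl))).trans_le hq
    have := mul_pos h1 (hxy _ le_rfl)
    rwa [esymQuot, div_mul_cancel₀ _ (hxy _ le_rfl).ne'] at this

lemma prod_esymQuot {S : Finset ι} {k : ℕ} {x : ι → ℝ} (hx : x ∈ Gamma S k) :
    ∏ j ∈ Finset.range k, esymQuot S j x = esym S k x := by
  induction k with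
  | zero => simp [esym_zero]
  | succ k ih =>
    rw [Finset.prod_range_succ, ih (Gamma_mono (Nat.le_succ _) hx), esymQuot,
      mul_div_cancel₀ _ (hx k (Nat.le_succ _)).ne']

end Esym

/-- Superadditivity of the geometric mean. -/
lemma geom_mean_superadditive {k : ℕ} (hk : 0 < k) {p q : ℕ → ℝ}
    (hp : ∀ j ∈ Finset.range k, 0 < p j) (hq : ∀ j ∈ Finset.range k, 0 < q j) :
    (∏ j ∈ Finset.range k, p j) ^ (1 / (k : ℝ)) + (∏ j ∈ Finset.range k, q j) ^ (1 / (k : ℝ)) ≤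
      (∏ j ∈ Finset.range k, (p j + q j)) ^ (1 / (k : ℝ)) := by
  have hk' : (0 : ℝ) < k := by exact_mod_cast hk
  have hs : ∀ j ∈ Finset.range k, 0 < p j + q j := fun j hj => add_pos (hp j hj) (hq j hj)
  have hS := Finset.prod_pos hs
  have amgm : ∀ r : ℕ → ℝ, (∀ j ∈ Finset.range k, 0 < r j) →
      (∏ j ∈ Finset.range k, r j) ^ (1 / (k : ℝ)) ≤
        (∏ j ∈ Finset.range k, (p j + q j)) ^ (1 / (k : ℝ)) *
          ∑ j ∈ Finset.range k, 1 / (k : ℝ) * (r j / (p j + q j)) := by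
    intro r hr
    have h := Real.geom_mean_le_arith_mean_weighted (Finset.range k) (fun _ => 1 / (k : ℝ))
      (fun j => r j / (p j + q j)) (fun _ _ => by positivity)
      (by simp [hk'.ne']) (fun j hj => (div_pos (hr j hj) (hs j hj)).le)
    rw [Real.finsetProd_rpow _ _ (fun j hj => (div_pos (hr j hj) (hs j hj)).le),
      Finset.prod_div_distrib, Real.div_rpow (Finset.prod_pos hr).le hS.le,
      div_le_iff₀ (Real.rpow_pos_of_pos hS _)] at h
    rw [mul_comm]; exact h
  refine (add_le_add (amgm p hp) (amgm q hq)).trans ?_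
  rw [← mul_add, ← Finset.sum_add_distrib]
  have : ∑ j ∈ Finset.range k, (1 / (k : ℝ) * (p j / (p j + q j)) +
      1 / (k : ℝ) * (q j / (p j + q j))) = 1 := by
    have h : ∀ j ∈ Finset.range k, (1 / (k : ℝ) * (p j / (p j + q j)) +
      1 / (k : ℝ) * (q j / (p j + q j))) = 1 / k := by
      intro j hj
      rw [← mul_add, ← add_div, div_self (hs j hj).ne', mul_one]
    rw [Finset.sum_congr rfl h]
    simp [hk'.ne']
  rw [this, mul_one]

section Sigma

variable {n : ℕ}

lemma sigma_eq_esym (k : ℕ) (lam : Fin n → ℝ) : sigma k lam = esym Finset.univ k lam := rfl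

lemma mem_gardingCone_iff {k : ℕ} {lam : Fin n → ℝ} :
    lam ∈ gardingCone n k ↔ lam ∈ Gamma Finset.univ k := by
  constructor
  · intro h j hj
    rcases Nat.eq_zero_or_pos j with rfl | h0
    · simp [esym_zero]
    · exact h j h0 hj
  · exact fun h j _ hj => h j hj

lemma sigmaRoot_superadditive {k : ℕ} (hk : 0 < k) {x y : Fin n → ℝ}
    (hx : x ∈ gardingCone n k) (hy : y ∈ gardingCone n k) :
    sigmaRoot k x + sigmaRoot k y ≤ sigmaRoot k (x + y) := by
  rw [mem_gardingCone_iff] at hx hy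
  obtain ⟨l, rfl⟩ : ∃ l, k = l + 1 := ⟨k - 1, by omega⟩
  have hxy := (Gamma_add_and_esymQuot_superadditive l _ x y hx hy).1
  have hpos : ∀ {z : Fin n → ℝ}, z ∈ Gamma Finset.univ (l + 1) → ∀ j ∈ Finset.range (l + 1),
      0 < esymQuot Finset.univ j z := fun hz j hj =>
    div_pos (hz _ (by simp at hj; omega)) (hz _ (by simp at hj; omega))
  simp only [sigmaRoot, sigma_eq_esym]
  rw [← prod_esymQuot hx, ← prod_esymQuot hy, ← prod_esymQuot hxy]
  refine (geom_mean_superadditive hk (hpos hx) (hpos hy)).trans ?_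
  refine Real.rpow_le_rpow (Finset.prod_nonneg fun j hj =>
    (add_pos (hpos hx j hj) (hpos hy j hj)).le) ?_ (by positivity)
  refine Finset.prod_le_prod (fun j hj => (add_pos (hpos hx j hj) (hpos hy j hj)).le)
    fun j hj => ?_
  have hj' : j + 1 ≤ l + 1 := by simp at hj; omega
  exact (Gamma_add_and_esymQuot_superadditive j _ x y (Gamma_mono hj' hx) (Gamma_mono hj' hy)).2

lemma sigma_smul (k : ℕ) (t : ℝ) (x : Fin n → ℝ) : sigma k (t • x) = t ^ k * sigma k x := by
  unfold sigma
  rw [Finset.mul_sum]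
  refine Finset.sum_congr rfl fun S hS => ?_
  simp [Finset.prod_mul_distrib, (Finset.mem_powersetCard.1 hS).2]

lemma sigmaRoot_smul {k : ℕ} (hk : 0 < k) {t : ℝ} (ht : 0 ≤ t) {x : Fin n → ℝ}
    (hx : 0 ≤ sigma k x) : sigmaRoot k (t • x) = t * sigmaRoot k x := by
  rw [sigmaRoot, sigma_smul, Real.mul_rpow (by positivity) hx, one_div,
    Real.pow_rpow_inv_natCast ht hk.ne', sigmaRoot, one_div]

lemma smul_mem_gardingCone {k : ℕ} {t : ℝ} (ht : 0 < t) {x : Fin n → ℝ}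
    (hx : x ∈ gardingCone n k) : t • x ∈ gardingCone n k := by
  intro j h1 h2
  rw [sigma_smul]
  exact mul_pos (pow_pos ht _) (hx j h1 h2)

lemma sigma_pos {k : ℕ} (hkn : k ≤ n) {x : Fin n → ℝ} (hx : ∀ i, 0 < x i) : 0 < sigma k x :=
  Finset.sum_pos (fun _ _ => Finset.prod_pos fun i _ => hx i)
    (Finset.powersetCard_nonempty.2 (by simpa using hkn))

lemma mem_gardingCone_of_pos {k : ℕ} (hkn : k ≤ n) {x : Fin n → ℝ} (hx : ∀ i, 0 < x i) :
    x ∈ gardingCone n k := fun _ _ h => sigma_pos (h.trans hkn) hx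

end Sigma

/-! ### Coefficient matrices of `σ_k^{1/k}` -/

section Coefficients

variable {n : ℕ}

open Polynomial in
lemma sigma_eq_coeff_prod {k : ℕ} (hkn : k ≤ n) (d : Fin n → ℝ) :
    sigma k d = (-1) ^ k * (∏ i, (X - C (d i))).coeff (n - k) := by
  have h := Finset.prod_X_add_C_coeff (Finset.univ : Finset (Fin n)) (fun i => -d i)
    (k := n - k) (by simp)
  simp only [C_neg, ← sub_eq_add_neg] at h
  rw [h, Finset.card_univ, Fintype.card_fin, Nat.sub_sub_self hkn, Finset.mul_sum, sigma]
  refine Finset.sum_congr rfl fun S hS => ?_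
  rw [Finset.prod_neg, (Finset.mem_powersetCard.1 hS).2, ← mul_assoc, ← mul_pow]
  simp

lemma sigma_eigs_eq_coeff {k : ℕ} (hkn : k ≤ n) {A : Matrix (Fin n) (Fin n) ℝ}
    (hA : A.IsHermitian) : sigma k (eigs A) = (-1) ^ k * A.charpoly.coeff (n - k) := by
  rw [hA.charpoly_eq, eigs, dif_pos hA, sigma_eq_coeff_prod hkn]
  rfl

/-- `σ_k` of the eigenvalues is the sum of the principal minors of order `k`. -/
lemma sigma_eigs_eq_sum_minors {k : ℕ} (hkn : k ≤ n) {A : Matrix (Fin n) (Fin n) ℝ}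
    (hA : A.IsHermitian) : sigma k (eigs A) = ∑ s ∈ Finset.univ.powersetCard k,
      (A.submatrix (Subtype.val : s → Fin n) (Subtype.val : s → Fin n)).det := by
  have h := A.charpoly_coeff_eq_sum_minors k (by simpa using hkn)
  rw [Fintype.card_fin] at h
  rw [sigma_eigs_eq_coeff hkn hA, h, ← mul_assoc, ← mul_pow]
  simp

lemma charpoly_conj (U : Matrix.unitaryGroup (Fin n) ℝ) (A : Matrix (Fin n) (Fin n) ℝ) :
    ((U : Matrix (Fin n) (Fin n) ℝ) * A * star (U : Matrix (Fin n) (Fin n) ℝ)).charpoly =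
      A.charpoly := by
  rw [Matrix.charpoly_mul_comm, ← mul_assoc, Unitary.coe_star_mul_self, one_mul]

lemma isHermitian_conj (U : Matrix.unitaryGroup (Fin n) ℝ) {A : Matrix (Fin n) (Fin n) ℝ}
    (hA : A.IsHermitian) :
    ((U : Matrix (Fin n) (Fin n) ℝ) * A * star (U : Matrix (Fin n) (Fin n) ℝ)).IsHermitian := by
  rw [Matrix.star_eq_conjTranspose]
  exact Matrix.isHermitian_mul_mul_conjTranspose _ hA

lemma isHermitian_diag (d : Fin n → ℝ) : (Matrix.diagonal d).IsHermitian :=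
  Matrix.isHermitian_diagonal d

lemma sigma_eigs_conj_diagonal {k : ℕ} (hkn : k ≤ n) (U : Matrix.unitaryGroup (Fin n) ℝ)
    (d : Fin n → ℝ) :
    sigma k (eigs ((U : Matrix (Fin n) (Fin n) ℝ) * Matrix.diagonal d *
      star (U : Matrix (Fin n) (Fin n) ℝ))) = sigma k d := by
  rw [sigma_eigs_eq_coeff hkn (isHermitian_conj U (isHermitian_diag d)), charpoly_conj,
    Matrix.charpoly_diagonal, ← sigma_eq_coeff_prod hkn]

lemma trace_conj_mul (U : Matrix.unitaryGroup (Fin n) ℝ) (M C : Matrix (Fin n) (Fin n) ℝ) :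
    (M * ((U : Matrix (Fin n) (Fin n) ℝ) * C * star (U : Matrix (Fin n) (Fin n) ℝ))).trace =
      (star (U : Matrix (Fin n) (Fin n) ℝ) * M * (U : Matrix (Fin n) (Fin n) ℝ) * C).trace := by
  rw [← mul_assoc, Matrix.trace_mul_comm]
  simp only [mul_assoc]

lemma conj_star_conj (U : Matrix.unitaryGroup (Fin n) ℝ) (M : Matrix (Fin n) (Fin n) ℝ) :
    (U : Matrix (Fin n) (Fin n) ℝ) * (star (U : Matrix (Fin n) (Fin n) ℝ) * M *
      (U : Matrix (Fin n) (Fin n) ℝ)) * star (U : Matrix (Fin n) (Fin n) ℝ) = M := by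
  have h := Unitary.mul_star_self_of_mem U.2
  calc _ = ((U : Matrix (Fin n) (Fin n) ℝ) * star (U : Matrix (Fin n) (Fin n) ℝ)) * M *
        ((U : Matrix (Fin n) (Fin n) ℝ) * star (U : Matrix (Fin n) (Fin n) ℝ)) := by
        simp only [mul_assoc]
    _ = M := by rw [h, one_mul, mul_one]

lemma isHermitian_smul {A : Matrix (Fin n) (Fin n) ℝ} (hA : A.IsHermitian) (t : ℝ) :
    (t • A).IsHermitian := by
  rw [Matrix.IsHermitian, Matrix.conjTranspose_smul, star_trivial, hA.eq]

lemma isSymm_of_isHermitian {A : Matrix (Fin n) (Fin n) ℝ} (hA : A.IsHermitian) : A.IsSymm := by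
  rwa [Matrix.IsHermitian, Matrix.conjTranspose_eq_transpose_of_trivial] at hA

lemma isHermitian_of_isSymm {A : Matrix (Fin n) (Fin n) ℝ} (hA : A.IsSymm) : A.IsHermitian := by
  rwa [Matrix.IsHermitian, Matrix.conjTranspose_eq_transpose_of_trivial]

/-- The spectrum of `Λ + t (E_{ij} + E_{ji})`, with `Λ` diagonal and `i ≠ j`, is even in `t`, since
`-t` is obtained from `t` by conjugation with the reflection of the `i`-th coordinate. -/
lemma charpoly_diagonal_add_offdiag (lam : Fin n → ℝ) {i j : Fin n} (hij : i ≠ j) (t : ℝ) :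
    (Matrix.diagonal lam + (-t) • (Matrix.single i j (1 : ℝ) + Matrix.single j i 1)).charpoly =
      (Matrix.diagonal lam + t • (Matrix.single i j (1 : ℝ) + Matrix.single j i 1)).charpoly := by
  set D : Matrix (Fin n) (Fin n) ℝ := Matrix.diagonal fun l => if l = i then -1 else 1
  have hD : D * D = 1 := by
    rw [Matrix.diagonal_mul_diagonal, ← Matrix.diagonal_one]
    congr 1; ext l; split_ifs <;> simp
  have h : Matrix.diagonal lam + (-t) • (Matrix.single i j (1 : ℝ) + Matrix.single j i 1) =
      D * (Matrix.diagonal lam + t • (Matrix.single i j (1 : ℝ) + Matrix.single j i 1)) * D := by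
    ext a b
    simp only [D, Matrix.mul_diagonal, Matrix.diagonal_mul, Matrix.add_apply, Matrix.smul_apply,
      Matrix.diagonal_apply, Matrix.single_apply, smul_eq_mul]
    have hji := hij.symm
    split_ifs <;> grind
  rw [h, Matrix.charpoly_mul_comm, ← mul_assoc, hD, one_mul]

lemma le_deriv_of_forall_pos {φ : ℝ → ℝ} {c d : ℝ} (hφ : HasDerivAt φ d 0)
    (h : ∀ t > 0, φ 0 + t * c ≤ φ t) : c ≤ d := by
  have h1 : Filter.Tendsto (fun t : ℝ => t⁻¹ • (φ (0 + t) - φ 0)) (𝓝[>] 0) (𝓝 d) :=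
    hφ.tendsto_slope_zero_right
  refine ge_of_tendsto h1 ?_
  filter_upwards [self_mem_nhdsWithin] with t ht
  have ht' : (0 : ℝ) < t := ht
  rw [zero_add, smul_eq_mul, ← div_eq_inv_mul, le_div_iff₀ ht']
  linarith [h t ht']

lemma eq_zero_of_hasDerivAt_even {φ : ℝ → ℝ} {d : ℝ} (hφ : HasDerivAt φ d 0)
    (h : ∀ t, φ (-t) = φ t) : d = 0 := by
  have h1 : HasDerivAt (fun t => φ (-t)) (-d) 0 := by
    rw [show -d = (-1 : ℝ) • d by simp]
    exact HasDerivAt.scomp (0 : ℝ) (h := fun t : ℝ => -t) (h' := -1) (g₁ := φ) (g₁' := d)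
      (by simpa using hφ) (hasDerivAt_neg (0 : ℝ))
  simp only [h] at h1
  linarith [h1.unique hφ]

/-- The eigenvalues `m` of a matrix of `𝓜_k` are positive and satisfy
`σ_k(β)^{1/k} ≤ ∑ m_i β_i` for all `β ∈ Γ_k`. The matrix is diagonal in the eigenbasis of the
matrix `T` at which the gradient is taken: by evenness the derivatives in the off-diagonal
directions vanish. The inequality is the superadditivity of `σ_k^{1/k}` along `λ(T) + t β`. -/
lemma exists_eigenvalues_of_mem_coeffsK {k : ℕ} (hk : 0 < k) (hkn : k ≤ n)
    {M : Matrix (Fin n) (Fin n) ℝ} (hM : M ∈ coeffsK n k) :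
    ∃ (U : Matrix.unitaryGroup (Fin n) ℝ) (m : Fin n → ℝ), (∀ i, 0 < m i) ∧
      M = (U : Matrix (Fin n) (Fin n) ℝ) * Matrix.diagonal m *
        star (U : Matrix (Fin n) (Fin n) ℝ) ∧
      ∀ β ∈ gardingCone n k, sigmaRoot k β ≤ ∑ i, m i * β i := by
  obtain ⟨hpd, T, hTs, hTΓ, hgrad⟩ := hM
  have hT := isHermitian_of_isSymm hTs
  set U := hT.eigenvectorUnitary
  set lam := eigs T with hlam
  have hTU : T = (U : Matrix (Fin n) (Fin n) ℝ) * Matrix.diagonal lam *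
      star (U : Matrix (Fin n) (Fin n) ℝ) := by
    have := hT.spectral_theorem
    rw [Unitary.conjStarAlgAut_apply] at this
    rw [hlam, eigs, dif_pos hT]
    exact this
  have hadd : ∀ (t : ℝ) (C : Matrix (Fin n) (Fin n) ℝ),
      T + t • ((U : Matrix (Fin n) (Fin n) ℝ) * C * star (U : Matrix (Fin n) (Fin n) ℝ)) =
      (U : Matrix (Fin n) (Fin n) ℝ) * (Matrix.diagonal lam + t • C) *
        star (U : Matrix (Fin n) (Fin n) ℝ) := by
    intro t C
    conv_lhs => rw [hTU]
    rw [mul_add, add_mul, Matrix.mul_smul, Matrix.smul_mul]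
  set N := star (U : Matrix (Fin n) (Fin n) ℝ) * M * (U : Matrix (Fin n) (Fin n) ℝ) with hN
  have hNpd : N.PosDef := by
    have := hpd.conjTranspose_mul_mul_same (B := (U : Matrix (Fin n) (Fin n) ℝ))
      (Matrix.mulVec_injective_of_isUnit (Unitary.isUnit_coe (U := U)))
    rwa [← Matrix.star_eq_conjTranspose] at this
  have hoff : ∀ i j, i ≠ j → N i j = 0 := by
    intro i j hij
    have hC : (Matrix.single i j (1 : ℝ) + Matrix.single j i 1).IsHermitian := by
      rw [Matrix.IsHermitian, Matrix.conjTranspose_add, Matrix.conjTranspose_single,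
        Matrix.conjTranspose_single, add_comm]
      simp
    have hd := hgrad _ (isSymm_of_isHermitian (isHermitian_conj U hC))
    have h0 := eq_zero_of_hasDerivAt_even hd fun t => by
      have hH : ∀ t : ℝ, (Matrix.diagonal lam +
          t • (Matrix.single i j (1 : ℝ) + Matrix.single j i 1)).IsHermitian := fun t =>
        (isHermitian_diag lam).add (isHermitian_smul hC t)
      simp only [sigmaRoot]
      rw [hadd, hadd, sigma_eigs_eq_coeff hkn (isHermitian_conj U (hH _)),
        sigma_eigs_eq_coeff hkn (isHermitian_conj U (hH _)), charpoly_conj, charpoly_conj,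
        charpoly_diagonal_add_offdiag lam hij]
    rw [trace_conj_mul, ← hN, mul_add, Matrix.trace_add, Matrix.trace_mul_single,
      Matrix.trace_mul_single] at h0
    have hsym := hNpd.isHermitian.apply i j
    simp only [star_trivial] at hsym
    simp at h0
    linarith
  have hdiag : N = Matrix.diagonal fun i => N i i := by
    ext i j
    by_cases h : i = j
    · subst h; simp
    · rw [hoff i j h, Matrix.diagonal_apply_ne _ h]
  refine ⟨U, fun i => N i i, fun i => hNpd.diag_pos, ?_, ?_⟩
  · rw [← hdiag, hN, conj_star_conj]
  · intro β hβ
    have hd := hgrad _ (isSymm_of_isHermitian (isHermitian_conj U (isHermitian_diag β)))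
    rw [trace_conj_mul, ← hN, hdiag, Matrix.diagonal_mul_diagonal, Matrix.trace_diagonal] at hd
    refine le_deriv_of_forall_pos hd fun t ht => ?_
    have h2 : ∀ t : ℝ, sigmaRoot k (eigs (T + t • ((U : Matrix (Fin n) (Fin n) ℝ) *
        Matrix.diagonal β * star (U : Matrix (Fin n) (Fin n) ℝ)))) =
        sigmaRoot k (lam + t • β) := by
      intro t
      rw [hadd, ← Matrix.diagonal_smul, Matrix.diagonal_add, sigmaRoot,
        sigma_eigs_conj_diagonal hkn]
      rfl
    rw [h2, h2, zero_smul, add_zero, ← sigmaRoot_smul hk ht.le (hβ k hk le_rfl).le]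
    exact sigmaRoot_superadditive hk hTΓ (smul_mem_gardingCone ht hβ)

lemma hasDerivAt_det_diagonal_add_smul {ι : Type*} [Fintype ι] [DecidableEq ι] {d : ι → ℝ}
    (hd : ∀ i, 0 < d i) (C : Matrix ι ι ℝ) :
    HasDerivAt (fun t : ℝ => (Matrix.diagonal d + t • C).det)
      (∑ i, (∏ j, d j) / d i * C i i) 0 := by
  have h1 : ∀ t : ℝ, (Matrix.diagonal d + t • C).det =
      (∏ j, d j) * (1 + t • (Matrix.diagonal (fun i => (d i)⁻¹) * C)).det := by
    intro t
    rw [← Matrix.det_diagonal, ← Matrix.det_mul, mul_add, mul_one, Matrix.mul_smul, ← mul_assoc,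
      Matrix.diagonal_mul_diagonal]
    simp [(hd _).ne']
  simp_rw [h1]
  conv => enter [1, t]; rw [Matrix.det_one_add_smul]
  generalize (Matrix.det (1 + (Polynomial.X : Polynomial ℝ) •
    (Matrix.diagonal (fun i => (d i)⁻¹) * C).map Polynomial.C)).divX.divX = P
  have h2 : ∑ i, (∏ j, d j) / d i * C i i =
      (∏ j, d j) * ((Matrix.diagonal (fun i => (d i)⁻¹) * C).trace + 0) := by
    simp only [Matrix.trace, Matrix.diag_apply, Matrix.diagonal_mul, add_zero, Finset.mul_sum]
    exact Finset.sum_congr rfl fun i _ => by ring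
  rw [h2]
  refine HasDerivAt.const_mul _ (HasDerivAt.add ?_ ?_)
  · simpa using ((hasDerivAt_id (0 : ℝ)).const_mul
      (Matrix.diagonal (fun i => (d i)⁻¹) * C).trace).const_add 1
  · have h3 := (P.hasDerivAt 0).fun_mul (hasDerivAt_pow 2 (0 : ℝ))
    norm_num at h3
    exact h3

/-- For positive `lam` and orthogonal `U`, the gradient of `σ_k^{1/k}` at `U diag(lam) Uᵀ` is a
matrix of `𝓜_k` with the same eigenvectors; its eigenvalues are at most
`σ_k(lam)^{1/k} / lam_i`. -/
lemma exists_mem_coeffsK {k : ℕ} (hk : 0 < k) (hkn : k ≤ n) (U : Matrix.unitaryGroup (Fin n) ℝ)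
    {lam : Fin n → ℝ} (hlam : ∀ i, 0 < lam i) :
    ∃ m : Fin n → ℝ, (∀ i, 0 < m i) ∧ (∀ i, m i * lam i ≤ sigmaRoot k lam) ∧
      (U : Matrix (Fin n) (Fin n) ℝ) * Matrix.diagonal m *
        star (U : Matrix (Fin n) (Fin n) ℝ) ∈ coeffsK n k := by
  have hσ : 0 < sigma k lam := sigma_pos hkn hlam
  have hk' : (1 : ℝ) ≤ k := by exact_mod_cast hk
  set c : ℝ := 1 / (k : ℝ) * sigma k lam ^ (1 / (k : ℝ) - 1) with hc
  have hcpos : 0 < c := by positivity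
  set g : Fin n → ℝ := fun i => ∑ s ∈ Finset.univ.powersetCard k,
    if i ∈ s then (∏ j ∈ s, lam j) / lam i else 0 with hg
  have hgpos : ∀ i, 0 < g i := by
    intro i
    refine Finset.sum_pos' (fun s _ => ?_) ?_
    · split_ifs
      exacts [(div_pos (Finset.prod_pos fun j _ => hlam j) (hlam i)).le, le_rfl]
    · obtain ⟨s, hs1, -, hs2⟩ := Finset.exists_subsuperset_card_eq
        (Finset.subset_univ ({i} : Finset (Fin n))) (n := k) (by simpa using Nat.succ_le_of_lt hk)
        (by simpa using hkn)
      refine ⟨s, by simp [Finset.mem_powersetCard, hs2], ?_⟩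
      rw [if_pos (hs1 (Finset.mem_singleton_self i))]
      exact div_pos (Finset.prod_pos fun j _ => hlam j) (hlam i)
  refine ⟨fun i => c * g i, fun i => mul_pos hcpos (hgpos i), fun i => ?_, ?_⟩
  · have h1 : g i * lam i ≤ sigma k lam := by
      rw [hg, sigma, Finset.sum_mul]
      refine Finset.sum_le_sum fun s _ => ?_
      split_ifs
      · rw [div_mul_cancel₀ _ (hlam i).ne']
      · rw [zero_mul]; exact Finset.prod_nonneg fun j _ => (hlam j).le
    have h2 : c * sigma k lam = 1 / (k : ℝ) * sigmaRoot k lam := by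
      rw [hc, mul_assoc, sigmaRoot, Real.rpow_sub_one hσ.ne', div_mul_cancel₀ _ hσ.ne']
    have h3 : 0 < sigmaRoot k lam := Real.rpow_pos_of_pos hσ _
    calc c * g i * lam i = c * (g i * lam i) := by ring
      _ ≤ c * sigma k lam := by gcongr
      _ = 1 / (k : ℝ) * sigmaRoot k lam := h2
      _ ≤ 1 * sigmaRoot k lam := by
        gcongr
        rw [div_le_one (by linarith)]; exact hk'
      _ = _ := one_mul _
  · have hpd : (Matrix.diagonal fun i => c * g i).PosDef :=
      Matrix.PosDef.diagonal fun i => mul_pos hcpos (hgpos i)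
    refine ⟨?_, (U : Matrix (Fin n) (Fin n) ℝ) * Matrix.diagonal lam *
      star (U : Matrix (Fin n) (Fin n) ℝ),
      isSymm_of_isHermitian (isHermitian_conj U (isHermitian_diag lam)), ?_, ?_⟩
    · have := hpd.conjTranspose_mul_mul_same (B := star (U : Matrix (Fin n) (Fin n) ℝ))
        (Matrix.mulVec_injective_of_isUnit ((Unitary.isUnit_coe (U := U)).star))
      rwa [← Matrix.star_eq_conjTranspose, star_star] at this
    · intro j h1 h2
      rw [sigma_eigs_conj_diagonal (h2.trans hkn)]
      exact sigma_pos (h2.trans hkn) hlam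
    · intro B hB
      set C := star (U : Matrix (Fin n) (Fin n) ℝ) * B * (U : Matrix (Fin n) (Fin n) ℝ) with hC
      have hBC := conj_star_conj U B
      rw [← hC] at hBC
      have hCH : C.IsHermitian := by
        rw [hC, Matrix.star_eq_conjTranspose]
        exact Matrix.isHermitian_conjTranspose_mul_mul _ (isHermitian_of_isSymm hB)
      have hsum : ∀ t : ℝ, sigma k (eigs ((U : Matrix (Fin n) (Fin n) ℝ) * Matrix.diagonal lam *
          star (U : Matrix (Fin n) (Fin n) ℝ) + t • B)) = ∑ s ∈ Finset.univ.powersetCard k,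
          (Matrix.diagonal (fun i : s => lam i) + t • (C.submatrix (Subtype.val : s → Fin n)
            (Subtype.val : s → Fin n))).det := by
        intro t
        have hH : (Matrix.diagonal lam + t • C).IsHermitian :=
          (isHermitian_diag lam).add (isHermitian_smul hCH t)
        rw [← hBC, ← Matrix.smul_mul, ← Matrix.mul_smul, ← add_mul, ← mul_add,
          sigma_eigs_eq_coeff hkn (isHermitian_conj U hH), charpoly_conj,
          ← sigma_eigs_eq_coeff hkn hH, sigma_eigs_eq_sum_minors hkn hH]
        refine Finset.sum_congr rfl fun s _ => ?_
        congr 1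
        ext a b
        simp only [Matrix.submatrix_apply, Matrix.add_apply, Matrix.smul_apply,
          Matrix.diagonal_apply, Subtype.coe_inj]
      have hder : HasDerivAt (fun t : ℝ => sigma k (eigs ((U : Matrix (Fin n) (Fin n) ℝ) *
          Matrix.diagonal lam * star (U : Matrix (Fin n) (Fin n) ℝ) + t • B)))
          (∑ i, g i * C i i) 0 := by
        simp only [hsum]
        have h1 : ∑ i, g i * C i i = ∑ s ∈ Finset.univ.powersetCard k, ∑ i : s,
            (∏ j : s, lam j) / lam i *
              (C.submatrix (Subtype.val : s → Fin n) (Subtype.val : s → Fin n)) i i := by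
          simp only [hg, Finset.sum_mul]
          rw [Finset.sum_comm]
          refine Finset.sum_congr rfl fun s _ => ?_
          rw [Finset.prod_coe_sort s lam]
          simp only [Matrix.submatrix_apply]
          rw [Finset.sum_coe_sort s fun i => (∏ j ∈ s, lam j) / lam i * C i i]
          simp only [ite_mul, zero_mul]
          rw [Finset.sum_ite_mem, Finset.univ_inter]
        rw [h1]
        exact HasDerivAt.fun_sum fun s _ => 
          hasDerivAt_det_diagonal_add_smul (d := fun i : s => lam i) (fun i => hlam i) _
      have hval := sigma_eigs_conj_diagonal hkn U lam
      have hroot := hder.rpow_const (p := 1 / (k : ℝ)) (Or.inl (by simp [hval, hσ.ne']))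
      have hgoal : ((U : Matrix (Fin n) (Fin n) ℝ) * Matrix.diagonal (fun i => c * g i) *
          star (U : Matrix (Fin n) (Fin n) ℝ) * B).trace = (∑ i, g i * C i i) * (1 / (k : ℝ)) *
          sigma k (eigs ((U : Matrix (Fin n) (Fin n) ℝ) * Matrix.diagonal lam *
          star (U : Matrix (Fin n) (Fin n) ℝ) + (0 : ℝ) • B)) ^ (1 / (k : ℝ) - 1) := by
        rw [zero_smul, add_zero, hval, Matrix.trace_mul_comm, trace_conj_mul, ← hC,
          Matrix.trace, Finset.sum_mul, Finset.sum_mul]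
        refine Finset.sum_congr rfl fun i _ => ?_
        rw [Matrix.diag_apply, Matrix.mul_diagonal, hc]; ring
      rw [hgoal]
      exact hroot

/-- `k` of the eigenvalues of a matrix of `𝓜_k` have a sum comparable to the largest eigenvalue:
the vector with entries `1` at these places, a small negative entry at one other place, and `0`
elsewhere lies in `Γ_k`. -/
lemma le_sum_eigenvalues {k : ℕ} {m : Fin n → ℝ} (hm : ∀ i, 0 < m i)
    (h : ∀ β ∈ gardingCone n k, sigmaRoot k β ≤ ∑ i, m i * β i)
    {A : Finset (Fin n)} (hA : A.card = k) (l : Fin n) :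
    m l ≤ 2 ^ (n + 1) * ∑ i ∈ A, m i := by
  by_cases hl : l ∈ A
  · have h1 : m l ≤ ∑ i ∈ A, m i := Finset.single_le_sum (fun i _ => (hm i).le) hl
    have h2 : (1 : ℝ) ≤ 2 ^ (n + 1) := one_le_pow₀ (by norm_num)
    nlinarith [hm l]
  set ε : ℝ := (2 ^ (n + 1))⁻¹ with hε
  have hεpos : 0 < ε := by positivity
  set β : Fin n → ℝ := fun i => if i ∈ A then 1 else if i = l then -ε else 0 with hβ
  have hβA : ∀ S ⊆ A, ∏ i ∈ S, β i = 1 := fun S hS =>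
    Finset.prod_eq_one fun i hi => by simp [hβ, hS hi]
  have hterm : ∀ S : Finset (Fin n), -ε ≤ ∏ i ∈ S, β i := by
    intro S
    by_cases hlS : l ∈ S
    · rw [← Finset.mul_prod_erase S β hlS]
      have h1 : β l = -ε := by simp [hβ, hl]
      have h2 : ∏ i ∈ S.erase l, β i ≤ 1 := by
        refine Finset.prod_le_one (fun i hi => ?_) fun i hi => ?_
        all_goals
          have := Finset.ne_of_mem_erase hi
          simp only [hβ, this, if_false]
          split_ifs <;> norm_num
      rw [h1]; nlinarith
    · have : 0 ≤ ∏ i ∈ S, β i := Finset.prod_nonneg fun i hi => by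
        have : i ≠ l := by rintro rfl; exact hlS hi
        simp only [hβ, this, if_false]
        split_ifs <;> norm_num
      linarith
  have hΓ : β ∈ gardingCone n k := by
    intro j hj1 hj2
    obtain ⟨S, hS, hSc⟩ := Finset.exists_subset_card_eq (s := A) (n := j) (by omega)
    have hmem : S ∈ Finset.powersetCard j (Finset.univ : Finset (Fin n)) := by
      simp [Finset.mem_powersetCard, hSc]
    rw [sigma, ← Finset.add_sum_erase _ _ hmem, hβA S hS]
    have h1 : ∑ S' ∈ (Finset.powersetCard j (Finset.univ : Finset (Fin n))).erase S, (-ε) ≤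
        ∑ S' ∈ (Finset.powersetCard j (Finset.univ : Finset (Fin n))).erase S, ∏ i ∈ S', β i :=
      Finset.sum_le_sum fun S' _ => hterm S'
    rw [Finset.sum_const, nsmul_eq_mul] at h1
    have h2 : ((Finset.powersetCard j (Finset.univ : Finset (Fin n))).erase S).card ≤ 2 ^ n := by
      refine (Finset.card_le_card ((Finset.erase_subset _ _).trans
        (Finset.subset_univ _))).trans ?_
      simp
    have h3 : (((Finset.powersetCard j (Finset.univ : Finset (Fin n))).erase S).card : ℝ) ≤
        2 ^ n := by exact_mod_cast h2
    have h4 : 2 ^ n * ε = 1 / 2 := by rw [hε, pow_succ]; field_simp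
    nlinarith
  have h1 := h β hΓ
  have h2 : ∑ i, m i * β i = ∑ i ∈ A, m i - ε * m l := by
    have : ∀ i, m i * β i = (if i ∈ A then m i else 0) - if i = l then ε * m i else 0 := by
      intro i
      by_cases hi : i ∈ A
      · have : i ≠ l := by rintro rfl; exact hl hi
        simp [hβ, hi, this]
      · by_cases hil : i = l
        · subst hil; simp [hβ, hi, mul_comm]
        · simp [hβ, hi, hil]
    simp only [this]
    rw [Finset.sum_sub_distrib]
    simp
  have h3 : 0 ≤ sigmaRoot k β := by
    by_cases hk : k = 0
    · simp [sigmaRoot, hk]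
    · exact (Real.rpow_pos_of_pos (hΓ k (Nat.pos_of_ne_zero hk) le_rfl) _).le
  rw [h2] at h1
  have h4 : ε * m l ≤ ∑ i ∈ A, m i := by linarith
  rwa [hε, inv_mul_le_iff₀ (by positivity)] at h4

/-- If a matrix of `𝓜_k` is nearly degenerate, then at most `k - 1` of its eigenvalues are not
large. -/
lemma exists_forall_card_lt {k : ℕ} (hk : 0 < k) (hkn : k ≤ n) {Λ : ℝ} (hΛ : 0 < Λ) :
    ∃ ε : ℝ, 0 < ε ∧ ∀ m : Fin n → ℝ, (∀ i, 0 < m i) →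
      (∀ β ∈ gardingCone n k, sigmaRoot k β ≤ ∑ i, m i * β i) → (∃ i, m i < ε) →
        (Finset.univ.filter fun i => m i < Λ).card < k := by
  set μ : ℝ := 2 ^ (n + 1) * (k * Λ) with hμ
  have hμpos : 0 < μ := by
    have : (0 : ℝ) < k := by exact_mod_cast hk
    positivity
  set a : ℝ := (n * μ + 2) ^ k with ha
  have ha1 : 1 ≤ a := one_le_pow₀ (by nlinarith [(Nat.cast_nonneg n : (0 : ℝ) ≤ n)])
  have hapos : 0 < a := by linarith
  refine ⟨a⁻¹, by positivity, ?_⟩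
  rintro m hm h ⟨i, hi⟩
  by_contra! hcard
  obtain ⟨A, hAs, hA⟩ := Finset.exists_subset_card_eq hcard
  have hmμ : ∀ l, m l ≤ μ := by
    intro l
    refine (le_sum_eigenvalues hm h hA l).trans ?_
    rw [hμ]
    gcongr
    calc ∑ i ∈ A, m i ≤ ∑ _i ∈ A, Λ :=
          Finset.sum_le_sum fun j hj => (Finset.mem_filter.1 (hAs hj)).2.le
      _ = k * Λ := by rw [Finset.sum_const, hA, nsmul_eq_mul]
  -- test the trace inequality with the vector `(a, 1, …, 1)`, whose `σ_k` is at least `a`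
  set β : Fin n → ℝ := fun j => if j = i then a else 1 with hβ
  have hβ1 : ∀ j, 1 ≤ β j := fun j => by simp only [hβ]; split_ifs <;> simp [ha1]
  have hβpos : ∀ j, 0 < β j := fun j => by linarith [hβ1 j]
  have h1 := h β (mem_gardingCone_of_pos hkn hβpos)
  have h2 : a ≤ sigma k β := by
    obtain ⟨s, hs1, -, hs2⟩ := Finset.exists_subsuperset_card_eq
      (Finset.subset_univ ({i} : Finset (Fin n))) (n := k) (by simpa using Nat.succ_le_of_lt hk)
        (by simpa using hkn)
    have his : i ∈ s := hs1 (Finset.mem_singleton_self i)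
    calc a = β i := by simp [hβ]
      _ ≤ ∏ j ∈ s, β j := by
        rw [← Finset.mul_prod_erase s β his]
        exact le_mul_of_one_le_right (hβpos i).le (Finset.one_le_prod fun j _ => hβ1 j)
      _ ≤ sigma k β := Finset.single_le_sum (f := fun s => ∏ j ∈ s, β j)
        (fun s _ => Finset.prod_nonneg fun j _ => (hβpos j).le)
        (by simp [Finset.mem_powersetCard, hs2])
  have h3 : n * μ + 2 ≤ sigmaRoot k β := by
    have : (n * μ + 2 : ℝ) = a ^ (1 / (k : ℝ)) := by
      rw [ha, one_div, Real.pow_rpow_inv_natCast (by positivity) hk.ne']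
    rw [this]
    exact Real.rpow_le_rpow hapos.le h2 (by positivity)
  have h4 : ∑ j, m j * β j ≤ m i * a + n * μ := by
    rw [← Finset.add_sum_erase _ _ (Finset.mem_univ i)]
    have h5 : m i * β i = m i * a := by simp [hβ]
    have h6 : ∑ j ∈ Finset.univ.erase i, m j * β j ≤ n * μ := by
      calc ∑ j ∈ Finset.univ.erase i, m j * β j ≤ ∑ _j ∈ Finset.univ.erase i, μ := by
            refine Finset.sum_le_sum fun j hj => ?_
            have := Finset.ne_of_mem_erase hj
            simpa [hβ, this] using hmμ j
        _ ≤ ∑ _j : Fin n, μ := Finset.sum_le_sum_of_subset_of_nonneg (Finset.erase_subset _ _)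
            fun _ _ _ => hμpos.le
        _ = n * μ := by simp
    linarith
  have h5 : m i * a < 1 := by
    have := mul_lt_mul_of_pos_right hi hapos
    rwa [inv_mul_cancel₀ hapos.ne'] at this
  linarith

end Coefficients

/-! ### The integrals in the eigenbasis of the coefficient matrix -/

section Integrals

open MeasureTheory

variable {n : ℕ}

/-- The linear map `z ↦ U diag(d) z`. -/
noncomputable def scaleMap (U : Matrix.unitaryGroup (Fin n) ℝ) (d : Fin n → ℝ) : E n →ₗ[ℝ] E n :=
  Matrix.toLpLin 2 2 ((U : Matrix (Fin n) (Fin n) ℝ) * Matrix.diagonal d)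

/-- The integral `∫ w(U diag(d) z) |z|^{-(n+2s)} dz`. With `w = δ(u,x,·)` and `d_i = √m_i` this is,
up to the factor `1/2`, the linear operator with the matrix `U diag(m) Uᵀ`. -/
noncomputable def scaledIntegral (w : E n → ℝ) (s : ℝ) (U : Matrix.unitaryGroup (Fin n) ℝ)
    (d : Fin n → ℝ) : ENNReal :=
  ∫⁻ z, ENNReal.ofReal (w (scaleMap U d z) / ‖z‖ ^ ((n : ℝ) + 2 * s))

lemma norm_toLpLin_unitary (U : Matrix.unitaryGroup (Fin n) ℝ) (z : E n) :
    ‖Matrix.toLpLin 2 2 (U : Matrix (Fin n) (Fin n) ℝ) z‖ = ‖z‖ := by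
  have h : ∀ y : E n, ‖y‖ ^ 2 = y.ofLp ⬝ᵥ y.ofLp := fun y => by
    rw [EuclideanSpace.real_norm_sq_eq]
    exact Finset.sum_congr rfl fun i _ => by ring
  have h1 : ‖Matrix.toLpLin 2 2 (U : Matrix (Fin n) (Fin n) ℝ) z‖ ^ 2 = ‖z‖ ^ 2 := by
    have hU := Unitary.star_mul_self_of_mem U.2
    rw [Matrix.star_eq_conjTranspose, Matrix.conjTranspose_eq_transpose_of_trivial] at hU
    rw [h, h, Matrix.toLpLin_apply]
    simp only
    rw [Matrix.dotProduct_mulVec, Matrix.vecMul_mulVec, hU, Matrix.vecMul_one]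
  exact (sq_eq_sq₀ (norm_nonneg _) (norm_nonneg _)).1 h1

lemma scaleMap_eq (U : Matrix.unitaryGroup (Fin n) ℝ) (d : Fin n → ℝ) (z : E n) :
    scaleMap U d z = Matrix.toLpLin 2 2 (U : Matrix (Fin n) (Fin n) ℝ)
      (WithLp.toLp 2 fun i => d i * z i) := by
  rw [scaleMap, Matrix.toLpLin_mul_same, LinearMap.comp_apply]
  congr 1
  ext i
  simp [Matrix.toLpLin_apply, Matrix.mulVec_diagonal]

lemma scaleMap_add (U : Matrix.unitaryGroup (Fin n) ℝ) (d e : Fin n → ℝ) (z : E n) :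
    scaleMap U (d + e) z = scaleMap U d z + scaleMap U e z := by
  simp only [scaleMap_eq, ← map_add]
  congr 1; ext i; simp; ring

lemma scaleMap_smul (U : Matrix.unitaryGroup (Fin n) ℝ) (c : ℝ) (d : Fin n → ℝ) (z : E n) :
    scaleMap U (c • d) z = c • scaleMap U d z := by
  simp only [scaleMap_eq, ← map_smul]
  congr 1; ext i; simp; ring

lemma norm_scaleMap_le (U : Matrix.unitaryGroup (Fin n) ℝ) {d : Fin n → ℝ} {D : ℝ}
    (hd : ∀ i, |d i| ≤ D) (hD : 0 ≤ D) (z : E n) : ‖scaleMap U d z‖ ≤ D * ‖z‖ := by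
  rw [scaleMap_eq, norm_toLpLin_unitary]
  refine (sq_le_sq₀ (norm_nonneg _) (by positivity)).1 ?_
  rw [mul_pow, EuclideanSpace.real_norm_sq_eq, EuclideanSpace.real_norm_sq_eq, Finset.mul_sum]
  refine Finset.sum_le_sum fun i _ => ?_
  simp only [mul_pow]
  have : d i ^ 2 ≤ D ^ 2 := sq_le_sq.2 ((hd i).trans (le_abs_self D))
  gcongr

lemma measurable_integrand {w : E n → ℝ} (hw : Measurable w) (s : ℝ)
    (U : Matrix.unitaryGroup (Fin n) ℝ) (d : Fin n → ℝ) :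
    Measurable fun z => ENNReal.ofReal (w (scaleMap U d z) / ‖z‖ ^ ((n : ℝ) + 2 * s)) := by
  have h : Measurable (scaleMap U d) :=
    (LinearMap.continuous_of_finiteDimensional (scaleMap U d)).measurable
  exact ((hw.comp h).div (measurable_norm.pow_const _)).ennreal_ofReal

open scoped MatrixOrder in
lemma sqrt_conj_diagonal (U : Matrix.unitaryGroup (Fin n) ℝ) {m : Fin n → ℝ}
    (hm : ∀ i, 0 < m i) :
    CFC.sqrt ((U : Matrix (Fin n) (Fin n) ℝ) * Matrix.diagonal m *
      star (U : Matrix (Fin n) (Fin n) ℝ)) =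
    (U : Matrix (Fin n) (Fin n) ℝ) * Matrix.diagonal (fun i => √(m i)) *
      star (U : Matrix (Fin n) (Fin n) ℝ) := by
  refine CFC.sqrt_unique ?_ ?_
  · have hU := Unitary.star_mul_self_of_mem U.2
    calc _ = (U : Matrix (Fin n) (Fin n) ℝ) * Matrix.diagonal (fun i => √(m i)) *
          (star (U : Matrix (Fin n) (Fin n) ℝ) * (U : Matrix (Fin n) (Fin n) ℝ)) *
          Matrix.diagonal (fun i => √(m i)) * star (U : Matrix (Fin n) (Fin n) ℝ) := by
          simp only [mul_assoc]
      _ = _ := by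
        rw [hU, mul_one, mul_assoc (U : Matrix (Fin n) (Fin n) ℝ),
          Matrix.diagonal_mul_diagonal]
        simp only [Real.mul_self_sqrt (hm _).le]
  · rw [Matrix.nonneg_iff_posSemidef, Matrix.star_eq_conjTranspose]
    exact (Matrix.PosSemidef.diagonal fun i => Real.sqrt_nonneg _).mul_mul_conjTranspose_same _

lemma inv_conj_diagonal (U : Matrix.unitaryGroup (Fin n) ℝ) {d : Fin n → ℝ}
    (hd : ∀ i, 0 < d i) :
    ((U : Matrix (Fin n) (Fin n) ℝ) * Matrix.diagonal d *
      star (U : Matrix (Fin n) (Fin n) ℝ))⁻¹ =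
    (U : Matrix (Fin n) (Fin n) ℝ) * Matrix.diagonal (fun i => (d i)⁻¹) *
      star (U : Matrix (Fin n) (Fin n) ℝ) := by
  refine Matrix.inv_eq_right_inv ?_
  have hU := Unitary.star_mul_self_of_mem U.2
  calc _ = (U : Matrix (Fin n) (Fin n) ℝ) * Matrix.diagonal d *
        (star (U : Matrix (Fin n) (Fin n) ℝ) * (U : Matrix (Fin n) (Fin n) ℝ)) *
        Matrix.diagonal (fun i => (d i)⁻¹) * star (U : Matrix (Fin n) (Fin n) ℝ) := by
        simp only [mul_assoc]
    _ = 1 := by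
      rw [hU, mul_one, mul_assoc (U : Matrix (Fin n) (Fin n) ℝ),
        Matrix.diagonal_mul_diagonal]
      simp [(hd _).ne', Unitary.mul_star_self_of_mem U.2]

open scoped MatrixOrder in
/-- The substitution `y = √M U z = U diag(√m) z` in the linear operator. -/
lemma lintegral_kernel_eq (s : ℝ) (U : Matrix.unitaryGroup (Fin n) ℝ) {m : Fin n → ℝ}
    (hm : ∀ i, 0 < m i) {M : Matrix (Fin n) (Fin n) ℝ}
    (hM : M = (U : Matrix (Fin n) (Fin n) ℝ) * Matrix.diagonal m *
      star (U : Matrix (Fin n) (Fin n) ℝ)) (g : E n → ℝ) :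
    ∫⁻ y, ENNReal.ofReal (1 / 2 *
      (g y / ‖Matrix.toLpLin 2 2 (CFC.sqrt M)⁻¹ y‖ ^ ((n : ℝ) + 2 * s) * ((CFC.sqrt M)⁻¹).det)) =
    ENNReal.ofReal (1 / 2) * scaledIntegral g s U (fun i => √(m i)) := by
  have hsm : ∀ i, 0 < √(m i) := fun i => Real.sqrt_pos.2 (hm i)
  have hU := Unitary.star_mul_self_of_mem U.2
  have hdetU : (U : Matrix (Fin n) (Fin n) ℝ).det * (U : Matrix (Fin n) (Fin n) ℝ).det = 1 := by
    have := congrArg Matrix.det hU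
    rwa [Matrix.det_mul, Matrix.star_eq_conjTranspose,
      Matrix.conjTranspose_eq_transpose_of_trivial, Matrix.det_transpose, Matrix.det_one] at this
  rw [hM, sqrt_conj_diagonal U hm, inv_conj_diagonal U hsm]
  set N := (U : Matrix (Fin n) (Fin n) ℝ) * Matrix.diagonal (fun i => (√(m i))⁻¹) *
      star (U : Matrix (Fin n) (Fin n) ℝ) with hN
  set A := scaleMap U (fun i => √(m i)) with hA
  have hNdet : N.det = ∏ i, (√(m i))⁻¹ := by
    rw [hN, Matrix.det_mul, Matrix.det_mul, Matrix.det_diagonal, Matrix.star_eq_conjTranspose,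
      Matrix.conjTranspose_eq_transpose_of_trivial, Matrix.det_transpose]
    rw [mul_comm, ← mul_assoc, hdetU, one_mul]
  have hAdet : LinearMap.det A = (U : Matrix (Fin n) (Fin n) ℝ).det * ∏ i, √(m i) := by
    rw [hA, scaleMap, LinearMap.det_toLpLin, Matrix.det_mul, Matrix.det_diagonal]
  have habs : |(U : Matrix (Fin n) (Fin n) ℝ).det| = 1 := by
    rw [← abs_mul_abs_self] at hdetU
    nlinarith [abs_nonneg (U : Matrix (Fin n) (Fin n) ℝ).det]
  have hprod : 0 < ∏ i, √(m i) := Finset.prod_pos fun i _ => hsm i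
  have hAne : LinearMap.det A ≠ 0 := by
    rw [hAdet]
    refine mul_ne_zero ?_ hprod.ne'
    intro h; rw [h] at hdetU; simp at hdetU
  have hAabs : |(LinearMap.det A)⁻¹| = N.det := by
    rw [abs_inv, hAdet, abs_mul, habs, one_mul, abs_of_pos hprod, hNdet, Finset.prod_inv_distrib]
  have hNpos : 0 < N.det := by rw [hNdet, Finset.prod_inv_distrib]; positivity
  have hNA : ∀ z, ‖Matrix.toLpLin 2 2 N (A z)‖ = ‖z‖ := by
    intro z
    rw [hA, scaleMap, ← LinearMap.comp_apply, ← Matrix.toLpLin_mul_same]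
    have : N * ((U : Matrix (Fin n) (Fin n) ℝ) * Matrix.diagonal fun i => √(m i)) = U := by
      calc _ = (U : Matrix (Fin n) (Fin n) ℝ) * Matrix.diagonal (fun i => (√(m i))⁻¹) *
            (star (U : Matrix (Fin n) (Fin n) ℝ) * (U : Matrix (Fin n) (Fin n) ℝ)) *
            Matrix.diagonal (fun i => √(m i)) := by rw [hN]; simp only [mul_assoc]
        _ = _ := by
          rw [hU, mul_one, mul_assoc, Matrix.diagonal_mul_diagonal]
          simp [(hsm _).ne']
    rw [this, norm_toLpLin_unitary]
  have hmap := Measure.map_linearMap_addHaar_eq_smul_addHaar (volume : Measure (E n)) hAne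
  have hemb : MeasurableEmbedding A := by
    exact (LinearMap.equivOfDetNeZero A
      hAne).toContinuousLinearEquiv.toHomeomorph.measurableEmbedding
  calc _ = ∫⁻ y, ENNReal.ofReal N.det * ENNReal.ofReal (1 / 2 *
        (g y / ‖Matrix.toLpLin 2 2 N y‖ ^ ((n : ℝ) + 2 * s))) := by
        refine lintegral_congr fun y => ?_
        rw [← ENNReal.ofReal_mul hNpos.le]; congr 1; ring
    _ = ∫⁻ y, ENNReal.ofReal (1 / 2 * (g y / ‖Matrix.toLpLin 2 2 N y‖ ^ ((n : ℝ) + 2 * s)))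
          ∂(Measure.map A volume) := by
        rw [lintegral_const_mul' _ _ ENNReal.ofReal_ne_top, hmap, lintegral_smul_measure, hAabs]
        rfl
    _ = ∫⁻ z, ENNReal.ofReal (1 / 2) *
          ENNReal.ofReal (g (A z) / ‖z‖ ^ ((n : ℝ) + 2 * s)) := by
        rw [hemb.lintegral_map]
        refine lintegral_congr fun z => ?_
        rw [hNA, ENNReal.ofReal_mul (by norm_num)]
    _ = _ := by rw [lintegral_const_mul' _ _ ENNReal.ofReal_ne_top, scaledIntegral]

lemma extIntegral_eq {g : E n → ℝ} (hg : ∀ y, 0 ≤ g y) :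
    extIntegral g = ((∫⁻ y, ENNReal.ofReal (g y) : ENNReal) : EReal) := by
  have h : ∀ y, ENNReal.ofReal (-g y) = 0 := fun y =>
    ENNReal.ofReal_of_nonpos (neg_nonpos.2 (hg y))
  simp [extIntegral, h]

lemma linOp_eq (s : ℝ) (U : Matrix.unitaryGroup (Fin n) ℝ) {m : Fin n → ℝ}
    (hm : ∀ i, 0 < m i) {M : Matrix (Fin n) (Fin n) ℝ}
    (hM : M = (U : Matrix (Fin n) (Fin n) ℝ) * Matrix.diagonal m *
      star (U : Matrix (Fin n) (Fin n) ℝ)) {u : E n → ℝ} {x : E n}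
    (hu : ∀ y, 0 ≤ delta u x y) :
    linOp s M u x = ((ENNReal.ofReal (1 / 2) *
      scaledIntegral (delta u x) s U (fun i => √(m i)) : ENNReal) : EReal) := by
  rw [← lintegral_kernel_eq s U hm hM, linOp, extIntegral_eq]
  intro y
  have hdet : 0 ≤ (((U : Matrix (Fin n) (Fin n) ℝ) * Matrix.diagonal (fun i => √(m i)) *
      star (U : Matrix (Fin n) (Fin n) ℝ))⁻¹).det := by
    rw [inv_conj_diagonal U fun i => Real.sqrt_pos.2 (hm i)]
    rw [Matrix.star_eq_conjTranspose]
    exact ((Matrix.PosSemidef.diagonal fun i =>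
      inv_nonneg.2 (Real.sqrt_nonneg _)).mul_mul_conjTranspose_same _).det_nonneg
  rw [hM, sqrt_conj_diagonal U hm]
  have := hu y
  positivity

/-! ### Bounds for the integrals -/

/-- The surface area of the unit sphere. -/
noncomputable def sphereArea (n : ℕ) : ℝ := n * volume.real (Metric.ball (0 : E n) 1)

lemma sphereArea_nonneg (n : ℕ) : 0 ≤ sphereArea n := by unfold sphereArea; positivity

/-- Polar coordinates for a function which is at most quadratic near `0` and at most linear near
infinity. -/
lemma lintegral_kernel_le (hn : 0 < n) {s a b : ℝ} (hs : 1 / 2 < s) (hs1 : s < 1) (ha : 0 ≤ a)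
    (hb : 0 ≤ b) {g : E n → ℝ} (hg1 : ∀ z, g z ≤ a * ‖z‖ ^ 2) (hg2 : ∀ z, g z ≤ b * ‖z‖) :
    ∫⁻ z, ENNReal.ofReal (g z / ‖z‖ ^ ((n : ℝ) + 2 * s)) ≤
      ENNReal.ofReal (sphereArea n * (a / (2 - 2 * s) + b / (2 * s - 1))) := by
  have : Nonempty (Fin n) := ⟨⟨0, hn⟩⟩
  have : Nontrivial (E n) := inferInstance
  set p : ℝ := (n : ℝ) + 2 * s with hp
  have hn1 : (1 : ℝ) ≤ n := by exact_mod_cast hn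
  set f : ℝ → ℝ := fun r => if r ≤ 1 then a * r ^ (2 - p) else b * r ^ (1 - p) with hf
  have hf0 : ∀ r, 0 ≤ r → 0 ≤ f r := fun r hr => by
    simp only [hf]; split_ifs <;> positivity
  have hle : ∀ z : E n, g z / ‖z‖ ^ p ≤ f ‖z‖ := by
    intro z
    rcases (norm_nonneg z).eq_or_lt with h0 | h0
    · rw [← h0, Real.zero_rpow (by linarith), div_zero]; exact hf0 0 le_rfl
    · simp only [hf]
      split_ifs with h
      · rw [Real.rpow_sub h0, mul_div_assoc', Real.rpow_two]
        gcongr; exact hg1 z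
      · rw [Real.rpow_sub h0, mul_div_assoc', Real.rpow_one]
        gcongr; exact hg2 z
  have h1 : ∀ y ∈ Set.Ioc (0 : ℝ) 1, y ^ (n - 1) • f y = a * y ^ (1 - 2 * s) := by
    intro y hy
    have hy0 := hy.1
    simp only [hf, if_pos hy.2, smul_eq_mul]
    rw [← Real.rpow_natCast, mul_left_comm, ← Real.rpow_add hy0, Nat.cast_sub hn]
    congr 2; rw [hp]; push_cast; ring
  have h2 : ∀ y ∈ Set.Ioi (1 : ℝ), y ^ (n - 1) • f y = b * y ^ (-(2 * s)) := by
    intro y hy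
    have hy0 : (0 : ℝ) < y := lt_trans one_pos hy
    simp only [hf, if_neg (not_le.2 (Set.mem_Ioi.1 hy)), smul_eq_mul]
    rw [← Real.rpow_natCast, mul_left_comm, ← Real.rpow_add hy0, Nat.cast_sub hn]
    congr 2; rw [hp]; push_cast; ring
  have hi1 : IntegrableOn (fun y : ℝ => y ^ (n - 1) • f y) (Set.Ioc 0 1) := by
    rw [integrableOn_congr_fun h1 measurableSet_Ioc]
    refine Integrable.const_mul ?_ a
    rw [← IntegrableOn, ← intervalIntegrable_iff_integrableOn_Ioc_of_le zero_le_one]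
    exact intervalIntegral.intervalIntegrable_rpow' (by linarith)
  have hi2 : IntegrableOn (fun y : ℝ => y ^ (n - 1) • f y) (Set.Ioi 1) := by
    rw [integrableOn_congr_fun h2 measurableSet_Ioi]
    exact Integrable.const_mul (integrableOn_Ioi_rpow_of_lt (by linarith) one_pos) b
  have hI : IntegrableOn (fun y : ℝ => y ^ (n - 1) • f y) (Set.Ioi 0) := by
    rw [← Set.Ioc_union_Ioi_eq_Ioi zero_le_one]
    exact hi1.union hi2
  have hint : Integrable (fun z : E n => f ‖z‖) := by
    rw [integrable_fun_norm_addHaar]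
    simpa using hI
  have hval : ∫ z : E n, f ‖z‖ = sphereArea n * (a / (2 - 2 * s) + b / (2 * s - 1)) := by
    rw [integral_fun_norm_addHaar]
    simp only [finrank_euclideanSpace, Fintype.card_fin]
    rw [← Set.Ioc_union_Ioi_eq_Ioi zero_le_one, setIntegral_union
      (Set.Ioc_disjoint_Ioi_same) measurableSet_Ioi hi1 hi2,
      setIntegral_congr_fun measurableSet_Ioc h1, setIntegral_congr_fun measurableSet_Ioi h2,
      integral_const_mul, integral_const_mul, ← intervalIntegral.integral_of_le zero_le_one,
      integral_rpow (Or.inl (by linarith)), integral_Ioi_rpow_of_lt (by linarith) one_pos,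
      Real.one_rpow, Real.one_rpow, Real.zero_rpow (by linarith), sphereArea]
    simp only [nsmul_eq_mul, smul_eq_mul]
    have e1 : 1 - 2 * s + 1 = 2 - 2 * s := by ring
    have e2 : -(2 * s) + 1 = -(2 * s - 1) := by ring
    rw [e1, e2, neg_div_neg_eq]
    ring
  calc _ ≤ ∫⁻ z : E n, ENNReal.ofReal (f ‖z‖) :=
        lintegral_mono fun z => ENNReal.ofReal_le_ofReal (hle z)
    _ = ENNReal.ofReal (∫ z : E n, f ‖z‖) :=
        (ofReal_integral_eq_lintegral_ofReal hint
          (Filter.Eventually.of_forall fun z => hf0 _ (norm_nonneg z))).symm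
    _ = _ := by rw [hval]

lemma scaledIntegral_le (hn : 0 < n) {s a b D : ℝ} (hs : 1 / 2 < s) (hs1 : s < 1) (ha : 0 ≤ a)
    (hb : 0 ≤ b) (hD : 0 ≤ D) {w : E n → ℝ} (hw1 : ∀ y, w y ≤ a * ‖y‖ ^ 2)
    (hw2 : ∀ y, w y ≤ b * ‖y‖) (U : Matrix.unitaryGroup (Fin n) ℝ) {d : Fin n → ℝ}
    (hd : ∀ i, |d i| ≤ D) :
    scaledIntegral w s U d ≤
      ENNReal.ofReal (sphereArea n * (a * D ^ 2 / (2 - 2 * s) + b * D / (2 * s - 1))) := by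
  refine lintegral_kernel_le hn hs hs1 (by positivity) (by positivity) (fun z => ?_) fun z => ?_
  · refine (hw1 _).trans ?_
    have := norm_scaleMap_le U hd hD z
    calc a * ‖scaleMap U d z‖ ^ 2 ≤ a * (D * ‖z‖) ^ 2 := by gcongr
      _ = _ := by ring
  · refine (hw2 _).trans ?_
    have := norm_scaleMap_le U hd hD z
    calc b * ‖scaleMap U d z‖ ≤ b * (D * ‖z‖) := by gcongr
      _ = _ := by ring

/-- After multiplication by `1 - s` the bound is uniform as `s → 1`. -/
lemma mul_scaledIntegral_le (hn : 0 < n) {s₀ s a b D : ℝ} (hs₀ : 1 / 2 < s₀) (hs : s₀ ≤ s)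
    (hs1 : s < 1) (ha : 0 ≤ a) (hb : 0 ≤ b) (hD : 0 ≤ D) {w : E n → ℝ}
    (hw1 : ∀ y, w y ≤ a * ‖y‖ ^ 2) (hw2 : ∀ y, w y ≤ b * ‖y‖)
    (U : Matrix.unitaryGroup (Fin n) ℝ) {d : Fin n → ℝ} (hd : ∀ i, |d i| ≤ D) :
    ENNReal.ofReal (1 - s) * scaledIntegral w s U d ≤
      ENNReal.ofReal (sphereArea n * (a * D ^ 2 + b * D / (2 * s₀ - 1))) := by
  refine (mul_le_mul_right (scaledIntegral_le hn (by linarith) hs1 ha hb hD hw1 hw2 U hd) _).trans ?_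
  rw [← ENNReal.ofReal_mul (by linarith)]
  refine ENNReal.ofReal_le_ofReal ?_
  rw [mul_left_comm]
  refine mul_le_mul_of_nonneg_left ?_ (sphereArea_nonneg n)
  rw [mul_add]
  have h1 : 0 < 1 - s := by linarith
  have h2 : 0 < 2 * s₀ - 1 := by linarith
  refine add_le_add ?_ ?_
  · have : (1 - s) * (a * D ^ 2 / (2 - 2 * s)) = a * D ^ 2 / 2 := by
      rw [show 2 - 2 * s = 2 * (1 - s) by ring]; field_simp
    rw [this]; have : 0 ≤ a * D ^ 2 := by positivity
    linarith
  · calc (1 - s) * (b * D / (2 * s - 1)) ≤ 1 * (b * D / (2 * s₀ - 1)) := by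
          have h3 : 0 < 2 * s - 1 := by linarith
          gcongr; linarith
      _ = _ := one_mul _

/-! ### Convexity -/

/-- Reflection of the `i`-th coordinate. -/
noncomputable def coordFlip (i : Fin n) : E n ≃ₗᵢ[ℝ] E n :=
  LinearIsometryEquiv.piLpCongrRight 2 fun j =>
    if j = i then LinearIsometryEquiv.neg ℝ else LinearIsometryEquiv.refl ℝ ℝ

lemma coordFlip_apply (i : Fin n) (z : E n) (j : Fin n) :
    coordFlip i z j = if j = i then -z j else z j := by
  simp only [coordFlip, LinearIsometryEquiv.piLpCongrRight_apply]
  split_ifs <;> simp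

lemma scaledIntegral_update_le {w : E n → ℝ} (hconv : ConvexOn ℝ Set.univ w)
    (hmeas : Measurable w) (hpos : ∀ y, 0 ≤ w y) (s : ℝ) (U : Matrix.unitaryGroup (Fin n) ℝ)
    (d : Fin n → ℝ) (i : Fin n) {t τ : ℝ} (ht : 0 ≤ t) (htτ : t ≤ τ) :
    scaledIntegral w s U (Function.update d i t) ≤
      scaledIntegral w s U (Function.update d i τ) := by
  rcases ht.trans htτ |>.eq_or_lt with h0 | hτ
  · obtain rfl : t = τ := by linarith
    exact le_rfl
  set q : ℝ := (1 + t / τ) / 2 with hq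
  have hr : t / τ ≤ 1 := (div_le_one hτ).2 htτ
  have hr0 : 0 ≤ t / τ := by positivity
  have hq0 : 0 ≤ q := by positivity
  have hq1 : 0 ≤ 1 - q := by rw [hq]; linarith
  set K : E n → ℝ := fun z => w (scaleMap U (Function.update d i τ) z) / ‖z‖ ^ ((n : ℝ) + 2 * s)
    with hK
  have hK0 : ∀ z, 0 ≤ K z := fun z => div_nonneg (hpos _) (by positivity)
  have hpt : ∀ z, w (scaleMap U (Function.update d i t) z) / ‖z‖ ^ ((n : ℝ) + 2 * s) ≤
      q * K z + (1 - q) * K (coordFlip i z) := by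
    intro z
    have he : scaleMap U (Function.update d i t) z =
        q • scaleMap U (Function.update d i τ) z +
          (1 - q) • scaleMap U (Function.update d i τ) (coordFlip i z) := by
      simp only [scaleMap_eq, ← map_smul, ← map_add]
      congr 1
      ext j
      simp only [PiLp.add_apply, PiLp.smul_apply, smul_eq_mul, coordFlip_apply]
      by_cases hj : j = i
      · subst hj
        simp only [Function.update_self, if_true, hq]
        field_simp; ring
      · simp only [Function.update_of_ne hj, if_neg hj]; ring
    have hc := hconv.2 (Set.mem_univ (scaleMap U (Function.update d i τ) z))
      (Set.mem_univ (scaleMap U (Function.update d i τ) (coordFlip i z))) hq0 hq1 (by ring)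
    rw [← he] at hc
    simp only [hK, LinearIsometryEquiv.norm_map]
    rw [mul_div_assoc', mul_div_assoc', ← add_div]
    exact div_le_div_of_nonneg_right hc (by positivity)
  calc scaledIntegral w s U (Function.update d i t)
      ≤ ∫⁻ z, (ENNReal.ofReal q * ENNReal.ofReal (K z) +
          ENNReal.ofReal (1 - q) * ENNReal.ofReal (K (coordFlip i z))) := by
        refine lintegral_mono fun z => ?_
        rw [← ENNReal.ofReal_mul hq0, ← ENNReal.ofReal_mul hq1,
          ← ENNReal.ofReal_add (mul_nonneg hq0 (hK0 _)) (mul_nonneg hq1 (hK0 _))]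
        exact ENNReal.ofReal_le_ofReal (hpt z)
    _ = ENNReal.ofReal q * (∫⁻ z, ENNReal.ofReal (K z)) +
          ENNReal.ofReal (1 - q) * ∫⁻ z, ENNReal.ofReal (K (coordFlip i z)) := by
        rw [lintegral_add_left ((measurable_integrand hmeas s U _).const_mul _),
          lintegral_const_mul' _ _ ENNReal.ofReal_ne_top,
          lintegral_const_mul' _ _ ENNReal.ofReal_ne_top]
    _ = ENNReal.ofReal q * (∫⁻ z, ENNReal.ofReal (K z)) +
          ENNReal.ofReal (1 - q) * ∫⁻ z, ENNReal.ofReal (K z) := by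
        congr 2
        exact (coordFlip i).measurePreserving.lintegral_comp_emb
          (coordFlip i).toHomeomorph.measurableEmbedding fun z => ENNReal.ofReal (K z)
    _ = scaledIntegral w s U (Function.update d i τ) := by
        rw [← add_mul, ← ENNReal.ofReal_add hq0 hq1]
        simp [scaledIntegral, hK]

/-- For convex `w` the integral is monotone in the scaling factors: changing the sign of a
coordinate does not change it, and `d_i` lies between `-d'_i` and `d'_i`. -/
lemma scaledIntegral_mono {w : E n → ℝ} (hconv : ConvexOn ℝ Set.univ w)
    (hmeas : Measurable w) (hpos : ∀ y, 0 ≤ w y) (s : ℝ) (U : Matrix.unitaryGroup (Fin n) ℝ)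
    {d d' : Fin n → ℝ} (hd : ∀ i, 0 ≤ d i) (hdd' : ∀ i, d i ≤ d' i) :
    scaledIntegral w s U d ≤ scaledIntegral w s U d' := by
  have h : ∀ S : Finset (Fin n),
      scaledIntegral w s U (S.piecewise d d') ≤ scaledIntegral w s U d' := by
    intro S
    induction S using Finset.induction_on with
    | empty => simp
    | insert i S hi ih =>
      refine le_trans ?_ ih
      rw [Finset.piecewise_insert]
      have := scaledIntegral_update_le hconv hmeas hpos s U (S.piecewise d d') i (hd i) (hdd' i)
      rwa [Function.update_eq_self_iff.2 (Finset.piecewise_eq_of_notMem _ _ _ hi).symm] at this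
  simpa using h Finset.univ

lemma mul_scaledIntegral_le_smul {w : E n → ℝ} (hconv : ConvexOn ℝ Set.univ w)
    (hzero : w 0 = 0) (s : ℝ) (U : Matrix.unitaryGroup (Fin n) ℝ) (d : Fin n → ℝ) {c : ℝ}
    (hc : 1 ≤ c) :
    ENNReal.ofReal c * scaledIntegral w s U d ≤ scaledIntegral w s U (c • d) := by
  have hc0 : 0 < c := by linarith
  rw [scaledIntegral, ← lintegral_const_mul' _ _ ENNReal.ofReal_ne_top]
  refine lintegral_mono fun z => ?_
  rw [← ENNReal.ofReal_mul hc0.le, scaleMap_smul, mul_div_assoc']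
  refine ENNReal.ofReal_le_ofReal (div_le_div_of_nonneg_right ?_ (by positivity))
  set y := scaleMap U d z
  have h := hconv.2 (Set.mem_univ (c • y)) (Set.mem_univ 0) (inv_nonneg.2 hc0.le)
    (sub_nonneg.2 (inv_le_one_of_one_le₀ hc)) (by ring)
  rw [smul_zero, add_zero, inv_smul_smul₀ hc0.ne', hzero, smul_zero, add_zero, smul_eq_mul,
    inv_mul_eq_div, le_div_iff₀ hc0] at h
  linarith

lemma scaledIntegral_add_le {w : E n → ℝ} (hconv : ConvexOn ℝ Set.univ w)
    (hmeas : Measurable w) (hpos : ∀ y, 0 ≤ w y) (s : ℝ) (U : Matrix.unitaryGroup (Fin n) ℝ)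
    (d e : Fin n → ℝ) :
    scaledIntegral w s U (d + e) ≤ ENNReal.ofReal (1 / 2) *
      (scaledIntegral w s U ((2 : ℝ) • d) + scaledIntegral w s U ((2 : ℝ) • e)) := by
  rw [scaledIntegral, scaledIntegral, scaledIntegral,
    ← lintegral_add_left (measurable_integrand hmeas s U _),
    ← lintegral_const_mul' _ _ ENNReal.ofReal_ne_top]
  refine lintegral_mono fun z => ?_
  rw [← ENNReal.ofReal_add (div_nonneg (hpos _) (by positivity))
    (div_nonneg (hpos _) (by positivity)), ← ENNReal.ofReal_mul (by norm_num), ← add_div,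
    mul_div_assoc', scaleMap_add, scaleMap_smul, scaleMap_smul]
  refine ENNReal.ofReal_le_ofReal (div_le_div_of_nonneg_right ?_ (by positivity))
  set y := scaleMap U d z
  set y' := scaleMap U e z
  have h := hconv.2 (Set.mem_univ ((2 : ℝ) • y)) (Set.mem_univ ((2 : ℝ) • y'))
    (by norm_num : (0 : ℝ) ≤ 1 / 2) (by norm_num : (0 : ℝ) ≤ 1 / 2) (by norm_num)
  rw [smul_smul, smul_smul] at h
  norm_num at h ⊢
  linarith

end Integrals

/-! ### Second differences of convex functions -/

section Delta

variable {n : ℕ} {u : E n → ℝ}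

lemma delta_nonneg (hu : ConvexOn ℝ Set.univ u) (x y : E n) : 0 ≤ delta u x y := by
  have h := hu.2 (Set.mem_univ (x + y)) (Set.mem_univ (x - y))
    (by norm_num : (0 : ℝ) ≤ 1 / 2) (by norm_num : (0 : ℝ) ≤ 1 / 2) (by norm_num)
  have he : (1 / 2 : ℝ) • (x + y) + (1 / 2 : ℝ) • (x - y) = x := by module
  rw [he] at h
  simp only [smul_eq_mul] at h
  unfold delta
  linarith

lemma delta_zero (x : E n) : delta u x 0 = 0 := by simp [delta]; ring

lemma convexOn_delta (hu : ConvexOn ℝ Set.univ u) (x : E n) :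
    ConvexOn ℝ Set.univ (delta u x) := by
  refine ⟨convex_univ, fun y _ z _ a b ha hb hab => ?_⟩
  have h1 := hu.2 (Set.mem_univ (x + y)) (Set.mem_univ (x + z)) ha hb hab
  have h2 := hu.2 (Set.mem_univ (x - y)) (Set.mem_univ (x - z)) ha hb hab
  have e1 : a • (x + y) + b • (x + z) = x + (a • y + b • z) := by
    rw [smul_add, smul_add, add_add_add_comm, ← add_smul, hab, one_smul]
  have e2 : a • (x - y) + b • (x - z) = x - (a • y + b • z) := by
    rw [smul_sub, smul_sub, sub_add_sub_comm, ← add_smul, hab, one_smul]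
  rw [e1] at h1
  rw [e2] at h2
  simp only [smul_eq_mul] at h1 h2 ⊢
  unfold delta
  have e3 : a * (2 * u x) + b * (2 * u x) = 2 * u x := by rw [← add_mul, hab, one_mul]
  linarith

lemma measurable_delta (hu : Continuous u) (x : E n) : Measurable (delta u x) := by
  unfold delta
  exact Continuous.measurable (by fun_prop)

lemma delta_le_of_lipschitz {L : ℝ≥0} (hu : LipschitzWith L u) (x y : E n) :
    delta u x y ≤ 2 * L * ‖y‖ := by
  have h1 := hu.dist_le_mul (x + y) x
  have h2 := hu.dist_le_mul (x - y) x
  rw [Real.dist_eq, dist_eq_norm] at h1 h2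
  rw [add_sub_cancel_left] at h1
  rw [sub_sub_cancel_left, norm_neg] at h2
  unfold delta
  linarith [le_abs_self (u (x + y) - u x), le_abs_self (u (x - y) - u x)]

/-- A convex function has a supporting affine function at each point. -/
lemma exists_subgradient (hu : ConvexOn ℝ Set.univ u) (hc : Continuous u) (x : E n) :
    ∃ l : E n →L[ℝ] ℝ, ∀ y, u x + l (y - x) ≤ u y := by
  set S : Set (E n × ℝ) := {p | p.1 ∈ Set.univ ∧ u p.1 < p.2}
  have hS : Convex ℝ S := hu.convex_strict_epigraph
  have hSo : IsOpen S := by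
    have : S = {p | u p.1 < p.2} := by ext p; simp [S]
    rw [this]
    exact isOpen_lt (hc.comp continuous_fst) continuous_snd
  obtain ⟨f, hf⟩ := geometric_hahn_banach_open_point hS hSo (x := (x, u x)) (by simp [S])
  set c : ℝ := f (0, 1) with hc'
  have hsplit : ∀ (y : E n) (t : ℝ), f (y, t) = f (y, 0) + t * c := by
    intro y t
    have : ((y, t) : E n × ℝ) = (y, 0) + t • (0, 1) := by simp
    rw [this, map_add, map_smul, smul_eq_mul]
  have hlt : ∀ (y : E n) (t : ℝ), u y < t → f (y, 0) + t * c < f (x, 0) + u x * c := by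
    intro y t ht
    have := hf (y, t) ⟨Set.mem_univ _, ht⟩
    rwa [hsplit y t, hsplit x (u x)] at this
  have hcneg : c < 0 := by
    have := hlt x (u x + 1) (by linarith)
    linarith
  have hle : ∀ y : E n, f (y, 0) + u y * c ≤ f (x, 0) + u x * c := by
    intro y
    refine le_of_forall_pos_lt_add fun ε hε => ?_
    have h1 : 0 < ε / (-c) := div_pos hε (by linarith)
    have := hlt y (u y + ε / (-c)) (by linarith)
    have h2 : ε / (-c) * c = -ε := by
      rw [div_neg, neg_mul, div_mul_cancel₀ _ hcneg.ne]
    rw [add_mul, h2] at this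
    linarith
  refine ⟨(-c)⁻¹ • f.comp (ContinuousLinearMap.inl ℝ (E n) ℝ), fun y => ?_⟩
  have h1 : f (y - x, 0) = f (y, 0) - f (x, 0) := by
    rw [← map_sub]; simp
  simp only [smul_apply, ContinuousLinearMap.comp_apply,
    ContinuousLinearMap.inl_apply, smul_eq_mul, h1]
  have h2 := hle y
  have h3 : (-c)⁻¹ * (f (y, 0) - f (x, 0)) ≤ u y - u x := by
    rw [inv_mul_le_iff₀ (by linarith)]
    linarith
  linarith

end Delta

/-! ### From the viscosity inequality to a pointwise inequality -/

section Viscosity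

open MeasureTheory Filter

variable {n : ℕ}

/-- The contribution of a quadratic function in a small ball tends to `0` with the radius. -/
lemma tendsto_scaledIntegral_ball (hn : 0 < n) {s c : ℝ} (hs : 1 / 2 < s) (hs1 : s < 1)
    (hc : 0 ≤ c) (U : Matrix.unitaryGroup (Fin n) ℝ) (d : Fin n → ℝ) :
    Tendsto (fun j : ℕ => scaledIntegral
      ((Metric.ball (0 : E n) (1 / ((j : ℝ) + 1))).indicator fun y => c * ‖y‖ ^ 2) s U d)
      atTop (𝓝 0) := by
  have hr : ∀ j : ℕ, 1 / ((j : ℝ) + 1) ≤ 1 := fun j => by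
    rw [div_le_one (by positivity)]; linarith [(Nat.cast_nonneg j : (0 : ℝ) ≤ j)]
  have hmeas : ∀ r : ℝ, Measurable ((Metric.ball (0 : E n) r).indicator fun y => c * ‖y‖ ^ 2) :=
    fun r => (by fun_prop : Measurable fun y : E n => c * ‖y‖ ^ 2).indicator measurableSet_ball
  have h1 : scaledIntegral ((Metric.ball (0 : E n) 1).indicator fun y => c * ‖y‖ ^ 2) s U d ≠ ⊤ := by
    have hd : ∀ i, |d i| ≤ ∑ i, |d i| := fun i =>
      Finset.single_le_sum (fun i _ => abs_nonneg (d i)) (Finset.mem_univ i)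
    refine ne_top_of_le_ne_top ENNReal.ofReal_ne_top (scaledIntegral_le hn hs hs1 hc hc
      (Finset.sum_nonneg fun i _ => abs_nonneg (d i)) (fun y => ?_) (fun y => ?_) U hd)
    · exact Set.indicator_le_self' (fun _ _ => by positivity) y
    · by_cases hy : y ∈ Metric.ball (0 : E n) 1
      · rw [Set.indicator_of_mem hy]
        have : ‖y‖ < 1 := by simpa using hy
        have h0 := norm_nonneg y
        have : ‖y‖ ^ 2 ≤ ‖y‖ := by nlinarith
        gcongr
      · rw [Set.indicator_of_notMem hy]; positivity
  have h2 : (∫⁻ _ : E n, (0 : ENNReal)) = 0 := by simp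
  rw [← h2]
  refine tendsto_lintegral_of_dominated_convergence _ (fun j => measurable_integrand (hmeas _) s U d)
    (fun j => Eventually.of_forall fun z => ?_) h1 (Eventually.of_forall fun z => ?_)
  · refine ENNReal.ofReal_le_ofReal (div_le_div_of_nonneg_right ?_ (by positivity))
    exact Set.indicator_le_indicator_of_subset (Metric.ball_subset_ball (hr j))
      (fun _ => by positivity) _
  · by_cases hz : scaleMap U d z = 0
    · have : ∀ j : ℕ, (Metric.ball (0 : E n) (1 / ((j : ℝ) + 1))).indicator
          (fun y => c * ‖y‖ ^ 2) (scaleMap U d z) = 0 := fun j => by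
        rw [hz, Set.indicator_of_mem (Metric.mem_ball_self (by positivity))]; simp
      simp only [this, zero_div, ENNReal.ofReal_zero]
      exact tendsto_const_nhds
    · refine tendsto_const_nhds.congr' ?_
      filter_upwards [(tendsto_one_div_add_atTop_nhds_zero_nat (𝕜 := ℝ)).eventually
        (gt_mem_nhds (norm_pos_iff.2 hz))] with j hj
      rw [Set.indicator_of_notMem]
      · simp
      · simpa using hj.le

/-- For a convex and semiconcave function the viscosity inequality holds pointwise: a supporting
affine function plus a paraboloid touches `u` from above at every point, and the ball where the
test function replaces `u` may shrink to a point. -/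
lemma le_scaledIntegral_of_viscosity {k : ℕ} (hn : 0 < n) {s η₀ SC : ℝ} {L : ℝ≥0}
    (hs : 1 / 2 < s) (hs1 : s < 1) (hη₀ : 0 < η₀) {Ω : Set (E n)} {u : E n → ℝ} (hΩ : IsOpen Ω)
    (hu : ConvexOn ℝ Set.univ u) (hL : LipschitzWith L u) (hSC : IsSemiconcaveOn Set.univ u SC)
    (hv : IsViscositySubsolution
      (fun v x => ((1 - s : ℝ) : EReal) * fracHess k s v x) (fun _ => η₀) Ω u)
    {x : E n} (hx : x ∈ Ω) (U : Matrix.unitaryGroup (Fin n) ℝ) {m : Fin n → ℝ}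
    (hm : ∀ i, 0 < m i) (hM : (U : Matrix (Fin n) (Fin n) ℝ) * Matrix.diagonal m *
      star (U : Matrix (Fin n) (Fin n) ℝ) ∈ coeffsK n k) :
    ENNReal.ofReal η₀ ≤ ENNReal.ofReal (1 - s) * (ENNReal.ofReal (1 / 2) *
      scaledIntegral (delta u x) s U (fun i => √(m i))) := by
  classical
  obtain ⟨-, hSC0, hsc⟩ := hSC
  obtain ⟨l, hl⟩ := exists_subgradient hu hL.continuous x
  obtain ⟨r₀, hr₀, hball⟩ := Metric.isOpen_iff.1 hΩ x hx
  set ψ : E n → ℝ := fun y => u x + l (y - x) + (SC + 1) * ‖y - x‖ ^ 2 with hψ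
  have hψx : ψ x = u x := by simp [hψ]
  have hψu : ∀ y, y ≠ x → u y < ψ y := by
    intro y hy
    have h1 := hsc x (y - x) (Set.subset_univ _)
    have h2 := hl (x - (y - x))
    have h3 : l (x - (y - x) - x) = -l (y - x) := by rw [← map_neg]; congr 1; abel
    have h4 : 0 < ‖y - x‖ ^ 2 := by
      have := norm_pos_iff.2 (sub_ne_zero.2 hy); positivity
    rw [h3] at h2
    rw [delta, add_sub_cancel] at h1
    simp only [hψ]
    linarith
  have hψC : ContDiff ℝ 2 ψ := by
    have h1 : ContDiff ℝ 2 fun y : E n => y - x := contDiff_id.sub contDiff_const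
    exact (contDiff_const.add (l.contDiff.comp h1)).add (contDiff_const.mul (h1.norm_sq ℝ))
  have hstep : ∀ r : ℝ, 0 < r → r < r₀ → ENNReal.ofReal η₀ ≤ ENNReal.ofReal (1 - s) *
      (ENNReal.ofReal (1 / 2) * (scaledIntegral (delta u x) s U (fun i => √(m i)) +
        scaledIntegral ((Metric.ball (0 : E n) r).indicator fun y => 2 * (SC + 1) * ‖y‖ ^ 2) s U
          (fun i => √(m i)))) := by
    intro r hr hrr
    have h1 := hv.2 x hx (Metric.ball x r) Metric.isOpen_ball (Metric.mem_ball_self hr)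
      ((Metric.ball_subset_ball hrr.le).trans hball) ψ hψC.contDiffOn hψx
      fun y hy => hψu y (by simpa using hy.2)
    simp only at h1
    set v : E n → ℝ := @Set.piecewise (E n) (fun _ => ℝ) (Metric.ball x r) ψ u
      (fun a => Classical.propDecidable (a ∈ Metric.ball x r)) with hvdef
    have hvx : v x = u x := by
      rw [hvdef, Set.piecewise_eq_of_mem _ _ _ (Metric.mem_ball_self hr), hψx]
    have hd1 : ∀ y ∈ Metric.ball (0 : E n) r, delta v x y = 2 * (SC + 1) * ‖y‖ ^ 2 := by
      intro y hy
      have hy' : ‖y‖ < r := by simpa using hy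
      have e1 : x + y ∈ Metric.ball x r := by simpa using hy'
      have e2 : x - y ∈ Metric.ball x r := by simpa [dist_eq_norm] using hy'
      rw [delta, hvx, hvdef, Set.piecewise_eq_of_mem _ _ _ e1, Set.piecewise_eq_of_mem _ _ _ e2]
      simp only [hψ, add_sub_cancel_left, sub_sub_cancel_left, map_neg, norm_neg]
      ring
    have hd2 : ∀ y ∉ Metric.ball (0 : E n) r, delta v x y = delta u x y := by
      intro y hy
      have hy' : ¬ ‖y‖ < r := by simpa using hy
      have e1 : x + y ∉ Metric.ball x r := by simpa using hy'
      have e2 : x - y ∉ Metric.ball x r := by simpa [dist_eq_norm] using hy'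
      rw [delta, hvx, hvdef, Set.piecewise_eq_of_notMem _ _ _ e1,
        Set.piecewise_eq_of_notMem _ _ _ e2, delta]
    have hd0 : ∀ y, 0 ≤ delta v x y := by
      intro y
      by_cases hy : y ∈ Metric.ball (0 : E n) r
      · rw [hd1 y hy]; positivity
      · rw [hd2 y hy]; exact delta_nonneg hu x y
    have h2 : fracHess k s v x ≤ ((ENNReal.ofReal (1 / 2) *
        scaledIntegral (delta v x) s U (fun i => √(m i)) : ENNReal) : EReal) := by
      rw [← linOp_eq s U hm rfl hd0]
      exact iInf₂_le _ hM
    have h3 : (η₀ : EReal) ≤ ((1 - s : ℝ) : EReal) * ((ENNReal.ofReal (1 / 2) *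
        scaledIntegral (delta v x) s U (fun i => √(m i)) : ENNReal) : EReal) :=
      h1.trans (mul_le_mul_of_nonneg_left h2 (by exact_mod_cast (by linarith : (0 : ℝ) ≤ 1 - s)))
    have hcoe : ∀ t : ℝ, 0 ≤ t → (t : EReal) = ((ENNReal.ofReal t : ENNReal) : EReal) :=
      fun t ht => by rw [EReal.coe_ennreal_ofReal, max_eq_left ht]
    rw [hcoe η₀ hη₀.le, hcoe (1 - s) (by linarith), ← EReal.coe_ennreal_mul,
      EReal.coe_ennreal_le_coe_ennreal_iff] at h3
    refine h3.trans (mul_le_mul_right (mul_le_mul_right ?_ _) _)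
    rw [scaledIntegral, scaledIntegral, scaledIntegral, ← lintegral_add_left
      (measurable_integrand (measurable_delta hL.continuous x) s U _)]
    refine lintegral_mono fun z => ?_
    set y := scaleMap U (fun i => √(m i)) z
    by_cases hy : y ∈ Metric.ball (0 : E n) r
    · rw [hd1 y hy, Set.indicator_of_mem hy]
      exact le_add_self
    · rw [hd2 y hy]
      exact le_self_add
  have hlim := tendsto_scaledIntegral_ball hn hs hs1 (c := 2 * (SC + 1)) (by positivity) U
    (fun i => √(m i))
  have hlim2 : Tendsto (fun j : ℕ => ENNReal.ofReal (1 - s) *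
      (ENNReal.ofReal (1 / 2) * (scaledIntegral (delta u x) s U (fun i => √(m i)) +
        scaledIntegral ((Metric.ball (0 : E n) (1 / ((j : ℝ) + 1))).indicator
          fun y => 2 * (SC + 1) * ‖y‖ ^ 2) s U (fun i => √(m i))))) atTop
      (𝓝 (ENNReal.ofReal (1 - s) * (ENNReal.ofReal (1 / 2) *
        (scaledIntegral (delta u x) s U (fun i => √(m i)) + 0)))) :=
    ENNReal.Tendsto.const_mul (ENNReal.Tendsto.const_mul (tendsto_const_nhds.add hlim)
      (Or.inr ENNReal.ofReal_ne_top)) (Or.inr ENNReal.ofReal_ne_top)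
  rw [add_zero] at hlim2
  refine ge_of_tendsto hlim2 ?_
  filter_upwards [(tendsto_one_div_add_atTop_nhds_zero_nat (𝕜 := ℝ)).eventually
    (gt_mem_nhds hr₀)] with j hj
  exact hstep _ (by positivity) hj

end Viscosity

/-! ### Nearly degenerate coefficients -/

section Degenerate

variable {n : ℕ}

lemma exists_eigenvalue_lt_of_lambdaMin_lt (hn : 0 < n) (U : Matrix.unitaryGroup (Fin n) ℝ)
    {m : Fin n → ℝ} {ε : ℝ}
    (h : lambdaMin ((U : Matrix (Fin n) (Fin n) ℝ) * Matrix.diagonal m *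
      star (U : Matrix (Fin n) (Fin n) ℝ)) < ε) : ∃ i, m i < ε := by
  have : Nonempty (Fin n) := ⟨⟨0, hn⟩⟩
  set M := (U : Matrix (Fin n) (Fin n) ℝ) * Matrix.diagonal m *
      star (U : Matrix (Fin n) (Fin n) ℝ) with hM
  have hH : M.IsHermitian := isHermitian_conj U (isHermitian_diag m)
  obtain ⟨j, hj⟩ := exists_eq_ciInf_of_finite (f := eigs M)
  have h1 : M.charpoly.eval (eigs M j) = 0 := by
    rw [hH.charpoly_eq, Polynomial.eval_prod]
    refine Finset.prod_eq_zero (Finset.mem_univ j) ?_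
    rw [eigs, dif_pos hH]
    simp
  rw [hM, charpoly_conj, Matrix.charpoly_diagonal, Polynomial.eval_prod,
    Finset.prod_eq_zero_iff] at h1
  obtain ⟨i, -, hi⟩ := h1
  rw [← hM] at hi
  simp only [Polynomial.eval_sub, Polynomial.eval_X, Polynomial.eval_C] at hi
  refine ⟨i, ?_⟩
  rw [lambdaMin, ← hj] at h
  linarith

lemma lambdaMin_pos (hn : 0 < n) {M : Matrix (Fin n) (Fin n) ℝ} (hM : M.PosDef) :
    0 < lambdaMin M := by
  have : Nonempty (Fin n) := ⟨⟨0, hn⟩⟩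
  obtain ⟨j, hj⟩ := exists_eq_ciInf_of_finite (f := eigs M)
  rw [lambdaMin, ← hj, eigs, dif_pos hM.isHermitian]
  exact hM.eigenvalues_pos j

/-- The point of `Γ_k` with entries `R` on fewer than `k` places and `R^{-(k-1)}` elsewhere. The
gradient of `σ_k^{1/k}` at this point is small on `S` and bounded elsewhere. -/
noncomputable def testPoint (k : ℕ) (S : Finset (Fin n)) (R : ℝ) : Fin n → ℝ :=
  fun i => if i ∈ S then R else (R ^ (k - 1))⁻¹

lemma sigmaRoot_testPoint_le {k : ℕ} (hk : 0 < k) (hkn : k ≤ n) {S : Finset (Fin n)}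
    (hS : S.card < k) {R : ℝ} (hR : 1 ≤ R) : sigmaRoot k (testPoint k S R) ≤ 2 ^ n := by
  have hR0 : 0 < R := by linarith
  have hpow : 1 ≤ R ^ (k - 1) := one_le_pow₀ hR
  have hpos : ∀ i, 0 < testPoint k S R i := fun i => by
    unfold testPoint; split_ifs <;> positivity
  have hle : ∀ i, testPoint k S R i ≤ R := fun i => by
    unfold testPoint; split_ifs
    · exact le_rfl
    · exact (inv_le_one_of_one_le₀ hpow).trans hR
  have h1 : sigma k (testPoint k S R) ≤ 2 ^ n := by
    have hterm : ∀ T ∈ Finset.powersetCard k (Finset.univ : Finset (Fin n)),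
        ∏ i ∈ T, testPoint k S R i ≤ 1 := by
      intro T hT
      have hTc := (Finset.mem_powersetCard.1 hT).2
      obtain ⟨i, hiT, hiS⟩ : ∃ i ∈ T, i ∉ S := by
        by_contra! h
        have := Finset.card_le_card (show T ⊆ S from h)
        omega
      rw [← Finset.mul_prod_erase T _ hiT]
      have e1 : testPoint k S R i = (R ^ (k - 1))⁻¹ := by simp [testPoint, hiS]
      have e2 : ∏ j ∈ T.erase i, testPoint k S R j ≤ R ^ (k - 1) := by
        refine (Finset.prod_le_prod (fun j _ => (hpos j).le) fun j _ => hle j).trans ?_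
        rw [Finset.prod_const, Finset.card_erase_of_mem hiT, hTc]
      rw [e1, inv_mul_le_iff₀ (by positivity), mul_one]
      exact e2
    calc sigma k (testPoint k S R) ≤
          ∑ _T ∈ Finset.powersetCard k (Finset.univ : Finset (Fin n)), (1 : ℝ) :=
          Finset.sum_le_sum hterm
      _ = ((Finset.powersetCard k (Finset.univ : Finset (Fin n))).card : ℝ) := by simp
      _ ≤ 2 ^ n := by
        have := Finset.card_le_card
          (Finset.subset_univ (Finset.powersetCard k (Finset.univ : Finset (Fin n))))
        rw [Finset.card_univ, Fintype.card_finset, Fintype.card_fin] at this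
        exact_mod_cast this
  have hk1 : (1 : ℝ) ≤ k := by exact_mod_cast hk
  calc sigmaRoot k (testPoint k S R) ≤ ((2 : ℝ) ^ n) ^ (1 / (k : ℝ)) :=
        Real.rpow_le_rpow (sigma_pos hkn hpos).le h1 (by positivity)
    _ ≤ ((2 : ℝ) ^ n) ^ (1 : ℝ) := by
        refine Real.rpow_le_rpow_of_exponent_le (one_le_pow₀ (by norm_num)) ?_
        rw [div_le_one (by linarith)]; exact hk1
    _ = 2 ^ n := Real.rpow_one _

/-- If the integral for the coefficient matrix with gradient point `testPoint k S R` is bounded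
below, then so is the integral over the directions outside `S` alone: the directions in `S` are
scaled by a small factor and contribute little. -/
lemma le_scaledIntegral_off {k : ℕ} (hk : 0 < k) (hkn : k ≤ n) {s₀ a b η₀ : ℝ}
    (hs₀ : 1 / 2 < s₀) (ha : 0 ≤ a) (hb : 0 ≤ b) (hη₀ : 0 < η₀) :
    ∃ κ : ℝ, 0 < κ ∧ ∀ s : ℝ, s₀ ≤ s → s < 1 → ∀ w : E n → ℝ, ConvexOn ℝ Set.univ w →
      Measurable w → (∀ y, 0 ≤ w y) → (∀ y, w y ≤ a * ‖y‖ ^ 2) → (∀ y, w y ≤ b * ‖y‖) →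
      ∀ U : Matrix.unitaryGroup (Fin n) ℝ,
      (∀ m : Fin n → ℝ, (∀ i, 0 < m i) → (U : Matrix (Fin n) (Fin n) ℝ) * Matrix.diagonal m *
        star (U : Matrix (Fin n) (Fin n) ℝ) ∈ coeffsK n k →
        ENNReal.ofReal η₀ ≤ ENNReal.ofReal (1 - s) * (ENNReal.ofReal (1 / 2) *
          scaledIntegral w s U (fun i => √(m i)))) →
      ∀ S : Finset (Fin n), S.card < k →
        ENNReal.ofReal η₀ ≤ ENNReal.ofReal (1 - s) * (ENNReal.ofReal (1 / 2) *
          scaledIntegral w s U (fun i => if i ∈ S then 0 else κ)) := by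
  have hn : 0 < n := hk.trans_le hkn
  have h2s : 0 < 2 * s₀ - 1 := by linarith
  set B : ℝ := sphereArea n * (a + b / (2 * s₀ - 1)) with hB
  have hB0 : 0 ≤ B := mul_nonneg (sphereArea_nonneg n) (by positivity)
  -- `D` is the scaling factor of the directions in `S`; it makes their contribution at most `η₀`
  set D : ℝ := min 1 (η₀ / (B + 1)) with hD
  have hD0 : 0 < D := lt_min one_pos (by positivity)
  have hD1 : D ≤ 1 := min_le_left _ _
  have hDB : B * D ≤ η₀ := by
    have h1 : D * (B + 1) ≤ η₀ := by
      rw [← le_div_iff₀ (by linarith)]; exact min_le_right _ _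
    nlinarith
  set R : ℝ := max 1 (2 ^ n / (D / 2) ^ 2) with hR
  have hR1 : 1 ≤ R := le_max_left _ _
  have hR0 : 0 < R := by linarith
  have hRD : 2 ^ n / R ≤ (D / 2) ^ 2 := by
    rw [div_le_iff₀ hR0, mul_comm, ← div_le_iff₀ (by positivity)]
    exact le_max_right _ _
  set q : ℝ := √(2 ^ n * R ^ (k - 1)) with hq
  have hq0 : 0 < q := Real.sqrt_pos.2 (by positivity)
  refine ⟨2 * q, by positivity, ?_⟩
  intro s hs hs1 w hconv hmeas hpos hw1 hw2 U hlow S hS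
  have hlam : ∀ i, 0 < testPoint k S R i := fun i => by
    unfold testPoint; split_ifs <;> positivity
  obtain ⟨m, hm, hmlam, hmem⟩ := exists_mem_coeffsK hk hkn U hlam
  have hroot := sigmaRoot_testPoint_le hk hkn hS hR1
  set d₁ : Fin n → ℝ := fun i => if i ∈ S then 0 else q with hd₁
  set d₂ : Fin n → ℝ := fun i => if i ∈ S then D / 2 else 0 with hd₂
  have hsqrt : ∀ i, √(m i) ≤ (d₁ + d₂) i := by
    intro i
    have h1 := (hmlam i).trans hroot
    by_cases hi : i ∈ S
    · simp only [Pi.add_apply, hd₁, hd₂, hi, if_true, zero_add]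
      simp only [testPoint, hi, if_true] at h1
      rw [Real.sqrt_le_left (by positivity)]
      exact ((le_div_iff₀ hR0).2 h1).trans hRD
    · simp only [Pi.add_apply, hd₁, hd₂, hi, if_false, add_zero, hq]
      simp only [testPoint, hi, if_false] at h1
      refine Real.sqrt_le_sqrt ?_
      rwa [← div_eq_mul_inv, div_le_iff₀ (by positivity)] at h1
  have h1 := hlow m hm hmem
  have h2 := (scaledIntegral_mono hconv hmeas hpos s U (fun i => Real.sqrt_nonneg _) hsqrt).trans
    (scaledIntegral_add_le hconv hmeas hpos s U d₁ d₂)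
  have e1 : (2 : ℝ) • d₁ = fun i => if i ∈ S then 0 else 2 * q := by
    ext i; simp only [hd₁, Pi.smul_apply, smul_eq_mul]; split_ifs <;> simp
  rw [e1] at h2
  have hd2 : ∀ i, |((2 : ℝ) • d₂) i| ≤ D := by
    intro i
    simp only [hd₂, Pi.smul_apply, smul_eq_mul]
    split_ifs
    · rw [abs_of_pos (by positivity)]; linarith
    · simp [hD0.le]
  have h3 : ENNReal.ofReal (1 - s) * scaledIntegral w s U ((2 : ℝ) • d₂) ≤
      ENNReal.ofReal η₀ := by
    refine (mul_scaledIntegral_le hn hs₀ hs hs1 ha hb hD0.le hw1 hw2 U hd2).trans ?_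
    refine ENNReal.ofReal_le_ofReal (le_trans ?_ hDB)
    have : a * D ^ 2 ≤ a * D := mul_le_mul_of_nonneg_left (by nlinarith) ha
    calc sphereArea n * (a * D ^ 2 + b * D / (2 * s₀ - 1)) ≤
          sphereArea n * (a * D + b * D / (2 * s₀ - 1)) := by
          have := sphereArea_nonneg n
          gcongr
      _ = B * D := by rw [hB]; ring
  set J := scaledIntegral w s U (fun i => if i ∈ S then 0 else 2 * q) with hJ
  set J₂ := scaledIntegral w s U ((2 : ℝ) • d₂) with hJ₂
  set t := ENNReal.ofReal (1 - s) with ht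
  set h := ENNReal.ofReal (1 / 2) with hh
  have hhh : h + h = 1 := by
    rw [hh, ← ENNReal.ofReal_add (by norm_num) (by norm_num)]; norm_num
  have h4 : ENNReal.ofReal η₀ ≤ h * (t * (h * J)) + h * (h * ENNReal.ofReal η₀) := by
    calc ENNReal.ofReal η₀ ≤ t * (h * (h * (J + J₂))) :=
          h1.trans (mul_le_mul_right (mul_le_mul_right h2 _) _)
      _ = h * (t * (h * J)) + h * (h * (t * J₂)) := by ring
      _ ≤ _ := by gcongr
  -- cancel: `η = h η + h η` and `h (h η) ≤ h η`
  have h5 : h * ENNReal.ofReal η₀ + h * ENNReal.ofReal η₀ ≤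
      h * (t * (h * J)) + h * ENNReal.ofReal η₀ := by
    rw [← add_mul, hhh, one_mul]
    refine h4.trans (add_le_add le_rfl (mul_le_mul_right ?_ _))
    calc h * ENNReal.ofReal η₀ ≤ 1 * ENNReal.ofReal η₀ := by
          gcongr; rw [← hhh]; exact le_self_add
      _ = _ := one_mul _
  have hne : h * ENNReal.ofReal η₀ ≠ ⊤ :=
    ENNReal.mul_ne_top ENNReal.ofReal_ne_top ENNReal.ofReal_ne_top
  have h6 := (ENNReal.add_le_add_iff_right hne).1 h5
  have hh0 : h ≠ 0 := by rw [hh]; simp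
  exact (ENNReal.mul_le_mul_iff_right hh0 ENNReal.ofReal_ne_top).1 h6

/-- For `s` in `[s₀, 1)` the infimum is not affected by the matrices of `𝓜_k` with a small
eigenvalue: each of them gives a larger value than one fixed matrix `M₀ ∈ 𝓜_k`. -/
lemma exists_theta {k : ℕ} (hk : 0 < k) (hkn : k ≤ n) {η₀ : ℝ} (hη₀ : 0 < η₀) (L : ℝ≥0) (SC : ℝ)
    {s₀ : ℝ} (hs₀ : 1 / 2 < s₀) :
    ∃ θ : ℝ, 0 < θ ∧ ∀ s : ℝ, s₀ ≤ s → s < 1 → ∀ (Ω : Set (E n)) (u : E n → ℝ), IsOpen Ω →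
      ConvexOn ℝ Set.univ u → LipschitzWith L u → IsSemiconcaveOn Set.univ u SC →
      IsViscositySubsolution (fun v x => ((1 - s : ℝ) : EReal) * fracHess k s v x)
        (fun _ => η₀) Ω u →
      ∀ x ∈ Ω, fracHess k s u x = fracHessTheta k s θ u x := by
  have hn : 0 < n := hk.trans_le hkn
  have h2s : 0 < 2 * s₀ - 1 := by linarith
  -- the semiconcavity constant may be negative only if there is no admissible `u`
  set a : ℝ := max SC 0 with ha
  have ha0 : 0 ≤ a := le_max_right _ _
  set b : ℝ := 2 * L with hb
  have hb0 : 0 ≤ b := by positivity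
  obtain ⟨κ, hκ, hoff⟩ := le_scaledIntegral_off (n := n) hk hkn hs₀ ha0 hb0 hη₀
  obtain ⟨m₀, hm₀, hm₀le, hM₀⟩ := exists_mem_coeffsK hk hkn (1 : Matrix.unitaryGroup (Fin n) ℝ)
    (lam := testPoint k ∅ 1) (fun i => by simp [testPoint])
  have hm₀' : ∀ i, m₀ i ≤ 2 ^ n := fun i => by
    have h1 := (hm₀le i).trans (sigmaRoot_testPoint_le hk hkn (S := ∅) (by simpa using hk) le_rfl)
    simpa [testPoint] using h1
  set M₀ := ((1 : Matrix.unitaryGroup (Fin n) ℝ) : Matrix (Fin n) (Fin n) ℝ) *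
    Matrix.diagonal m₀ *
      star ((1 : Matrix.unitaryGroup (Fin n) ℝ) : Matrix (Fin n) (Fin n) ℝ) with hM₀def
  -- an upper bound for `(1 - s)` times the integral for `M₀`
  set D₀ : ℝ := √(2 ^ n) with hD₀
  set C : ℝ := sphereArea n * (a * D₀ ^ 2 + b * D₀ / (2 * s₀ - 1)) with hC
  set c : ℝ := max 1 (C / η₀) with hc
  have hc1 : 1 ≤ c := le_max_left _ _
  have hcC : C ≤ c * η₀ := by
    rw [← div_le_iff₀ hη₀]; exact le_max_right _ _
  obtain ⟨ε, hε, hcard⟩ := exists_forall_card_lt (n := n) hk hkn (Λ := (c * κ) ^ 2) (by positivity)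
  refine ⟨min ε (lambdaMin M₀), lt_min hε (lambdaMin_pos hn hM₀.1), ?_⟩
  intro s hs hs1 Ω u hΩ hu hL hSC hv x hx
  set w := delta u x with hw
  have hconv := convexOn_delta hu x
  have hmeas := measurable_delta hL.continuous x
  have hpos := delta_nonneg hu x
  have hw1 : ∀ y, w y ≤ a * ‖y‖ ^ 2 := fun y =>
    (hSC.2.2 x y (Set.subset_univ _)).trans
      (mul_le_mul_of_nonneg_right (le_max_left _ _) (by positivity))
  have hw2 : ∀ y, w y ≤ b * ‖y‖ := fun y => delta_le_of_lipschitz hL x y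
  have ht0 : ENNReal.ofReal (1 - s) ≠ 0 := by simpa using hs1
  refine le_antisymm (le_iInf₂ fun M hM => iInf₂_le M hM.1) (le_iInf₂ fun M hM => ?_)
  by_cases hθ : min ε (lambdaMin M₀) ≤ lambdaMin M
  · exact iInf₂_le M ⟨hM, hθ⟩
  have hM₀θ : fracHessTheta k s (min ε (lambdaMin M₀)) u x ≤ linOp s M₀ u x :=
    iInf₂_le M₀ ⟨hM₀, min_le_right _ _⟩
  refine hM₀θ.trans ?_
  obtain ⟨U, m, hm, rfl, htrace⟩ := exists_eigenvalues_of_mem_coeffsK hk hkn hM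
  have hsmall := exists_eigenvalue_lt_of_lambdaMin_lt hn U
    ((not_le.1 hθ).trans_le (min_le_left _ _))
  set S := Finset.univ.filter fun i => m i < (c * κ) ^ 2 with hS
  have hSc : S.card < k := hcard m hm htrace hsmall
  have hlow := hoff s hs hs1 w hconv hmeas hpos hw1 hw2 U (fun m hm hmem =>
    le_scaledIntegral_of_viscosity hn (by linarith) hs1 hη₀ hΩ hu hL hSC hv hx U hm hmem) S hSc
  rw [linOp_eq s _ hm₀ hM₀def hpos, linOp_eq s U hm rfl hpos,
    EReal.coe_ennreal_le_coe_ennreal_iff]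
  have hup : ENNReal.ofReal (1 - s) * scaledIntegral w s 1 (fun i => √(m₀ i)) ≤
      ENNReal.ofReal C := by
    refine mul_scaledIntegral_le hn hs₀ hs hs1 ha0 hb0 (Real.sqrt_nonneg _) hw1 hw2 1 fun i => ?_
    rw [abs_of_nonneg (Real.sqrt_nonneg _)]
    exact Real.sqrt_le_sqrt (hm₀' i)
  have hbig : ENNReal.ofReal c * scaledIntegral w s U (fun i => if i ∈ S then 0 else κ) ≤
      scaledIntegral w s U (fun i => √(m i)) := by
    refine (mul_scaledIntegral_le_smul hconv (delta_zero x) s U _ hc1).trans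
      (scaledIntegral_mono hconv hmeas hpos s U (fun i => ?_) fun i => ?_)
    · simp only [Pi.smul_apply, smul_eq_mul]
      split_ifs <;> positivity
    · simp only [Pi.smul_apply, smul_eq_mul]
      by_cases hi : i ∈ S
      · simp [hi]
      · simp only [hi, if_false]
        refine Real.le_sqrt_of_sq_le ?_
        simpa [hS] using hi
  have hhalf : ENNReal.ofReal (1 / 2) ≤ 1 := by
    rw [← ENNReal.ofReal_one]; exact ENNReal.ofReal_le_ofReal (by norm_num)
  refine (ENNReal.mul_le_mul_iff_right ht0 ENNReal.ofReal_ne_top).1 ?_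
  calc ENNReal.ofReal (1 - s) * (ENNReal.ofReal (1 / 2) *
        scaledIntegral w s 1 fun i => √(m₀ i))
      = ENNReal.ofReal (1 / 2) * (ENNReal.ofReal (1 - s) *
        scaledIntegral w s 1 fun i => √(m₀ i)) := by ring
    _ ≤ 1 * ENNReal.ofReal C := mul_le_mul' hhalf hup
    _ ≤ ENNReal.ofReal (c * η₀) := by
      rw [one_mul]; exact ENNReal.ofReal_le_ofReal hcC
    _ = ENNReal.ofReal c * ENNReal.ofReal η₀ := ENNReal.ofReal_mul (by linarith)
    _ ≤ ENNReal.ofReal c * (ENNReal.ofReal (1 - s) * (ENNReal.ofReal (1 / 2) *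
          scaledIntegral w s U (fun i => if i ∈ S then 0 else κ))) := mul_le_mul_right hlow _
    _ = ENNReal.ofReal (1 - s) * (ENNReal.ofReal (1 / 2) * (ENNReal.ofReal c *
          scaledIntegral w s U (fun i => if i ∈ S then 0 else κ))) := by ring
    _ ≤ _ := mul_le_mul_right (mul_le_mul_right hbig _) _

end Degenerate

end FracHessian

theorem theorem1p3 (n k : ℕ) (hk : 2 ≤ k) (hkn : k ≤ n) (η₀ : ℝ) (hη₀ : 0 < η₀)
    (L : ℝ≥0) (SC : ℝ) :
    ∃ θ : ℝ → ℝ,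
      (∀ s : ℝ, 1 / 2 < s → s < 1 →
        0 < θ s ∧
        ∀ (Ω : Set (FracHessian.E n)) (u : FracHessian.E n → ℝ),
          IsOpen Ω →
          ConvexOn ℝ Set.univ u →
          LipschitzWith L u →
          FracHessian.IsSemiconcaveOn Set.univ u SC →
          FracHessian.IsViscositySubsolution
            (fun v x => ((1 - s : ℝ) : EReal) * FracHessian.fracHess k s v x)
            (fun _ => η₀) Ω u →
          ∀ x ∈ Ω, FracHessian.fracHess k s u x = FracHessian.fracHessTheta k s (θ s) u x) ∧
      ∃ θ₀ : ℝ, 0 < θ₀ ∧ ∀ᶠ s in 𝓝[<] (1 : ℝ), θ₀ ≤ θ s := by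
  have key : ∀ s₀ : ℝ, 1 / 2 < s₀ → _ := fun s₀ hs₀ =>
    FracHessian.exists_theta (n := n) (by omega : 0 < k) hkn hη₀ L SC hs₀
  choose! θ hθ using key
  have h34 : (1 / 2 : ℝ) < 3 / 4 := by norm_num
  -- one constant serves all `s ∈ [3/4, 1)`
  refine ⟨fun s => if 3 / 4 ≤ s then θ (3 / 4) else θ s, fun s hs hs1 => ?_, θ (3 / 4),
    (hθ _ h34).1, ?_⟩
  · by_cases h : 3 / 4 ≤ s
    · simp only [h, if_true]
      exact ⟨(hθ _ h34).1, (hθ _ h34).2 s h hs1⟩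
    · simp only [h, if_false]
      exact ⟨(hθ _ hs).1, (hθ _ hs).2 s le_rfl hs1⟩
  · filter_upwards [mem_nhdsWithin_of_mem_nhds (Ici_mem_nhds (by norm_num : (3 / 4 : ℝ) < 1))]
      with s hs
    rw [if_pos (Set.mem_Ici.1 hs)]
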